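/- Let $I=(0,1)$. For an immersed planar curve $\gamma\in H^2(I;\mathbb{R}^2)\subset C^1([0,1];\mathbb{R}^2)$ (that is, $\gamma'(x)\neq 0$ for all $x\in[0,1]$) write $\partial_s=|\gamma'|^{-1}\partial_x$ and $ds=|\gamma'|\,dx$, let $L[\gamma]=\int_\gamma ds$ be its length, $\kappa=\partial_s^2\gamma$ its curvature vector and $B[\gamma]=\int_\gamma|\kappa|^2\,ds$ its bending energy. Let $\theta\in H^1(I)\subset C([0,1])$ be a tangential angle function, i.e. $\partial_s\gamma=(\cos\theta,\sin\theta)$ on $[0,1]$ (unique modulo $2\pi$), let $k=\partial_s\theta$ be the signed curvature, and let $TC[\gamma]=\int_\gamma k\,ds=\theta(1)-\theta(0)$ be the total curvature. For $0\le\ell<1$ let $$A_\ell=\{\gamma\in H^2(I;\mathbb{R}^2)\ \text{immersed} : \gamma(0)=(0,0),\ \gamma(1)=(\ell,0),\ L[\gamma]=1\},\qquad A'_\ell=\{\gamma\in A_\ell : TC[\gamma]=0\},$$ and let $\varpi^*=\inf_{\gamma\in A_0}B[\gamma]$. Then $$\liminf_{\ell\downarrow 0}\Big(\inf_{\gamma\in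 A'_\ell}B[\gamma]\Big)\ \ge\ 4\varpi^*.$$ -/

import Mathlib

open Set MeasureTheory Filter Topology
open scoped ENNReal ContDiff

namespace PinnedCurve

/-- The Euclidean plane. -/
abbrev Plane : Type := EuclideanSpace ℝ (Fin 2)

/-- `g` is a weak derivative of `f` on the open interval `I = (0,1)`: both are locally integrable
on `I`, and `∫_I φ' f = - ∫_I φ g` for every smooth `φ` with compact support in `I`. -/
def HasWeakDeriv {E : Type*} [NormedAddCommGroup E] [NormedSpace ℝ E] (f g : ℝ → E) : Prop :=
  LocallyIntegrableOn f (Ioo 0 1) volume ∧ LocallyIntegrableOn g (Ioo 0 1) volume ∧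
    ∀ φ : ℝ → ℝ, ContDiff ℝ ∞ φ → HasCompactSupport φ → tsupport φ ⊆ Ioo 0 1 →
      ∫ x in Ioo (0 : ℝ) 1, deriv φ x • f x = -∫ x in Ioo (0 : ℝ) 1, φ x • g x

/-- `f ∈ L²(I)`. -/
def MemL2 {E : Type*} [NormedAddCommGroup E] (f : ℝ → E) : Prop :=
  MemLp f 2 (volume.restrict (Ioo (0 : ℝ) 1))

/-- `f ∈ H¹(I)`, where `f` is the representative that is continuous on `[0,1]`
(Sobolev embedding). Only the values on `[0,1]` matter. -/
def MemH1 {E : Type*} [NormedAddCommGroup E] [NormedSpace ℝ E] (f : ℝ → E) : Prop :=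
  ContinuousOn f (Icc 0 1) ∧ MemL2 f ∧ ∃ f₁ : ℝ → E, MemL2 f₁ ∧ HasWeakDeriv f f₁

/-- `f ∈ H²(I)`, where `f` is the representative that is continuous on `[0,1]`; this
representative is automatically of class `C¹` on `[0,1]`. Only the values on `[0,1]` matter. -/
def MemH2 {E : Type*} [NormedAddCommGroup E] [NormedSpace ℝ E] (f : ℝ → E) : Prop :=
  ContinuousOn f (Icc 0 1) ∧ MemL2 f ∧
    ∃ f₁ f₂ : ℝ → E, MemL2 f₁ ∧ MemL2 f₂ ∧ HasWeakDeriv f f₁ ∧ HasWeakDeriv f₁ f₂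

/-- The derivative in `x` on `[0,1]`, one-sided at the endpoints. For the continuous representative
of an `H¹` function it exists at almost every point and agrees a.e. with the weak derivative;
for the continuous representative of an `H²` function it exists at every point of `[0,1]`. -/
noncomputable def dx {E : Type*} [NormedAddCommGroup E] [NormedSpace ℝ E] (f : ℝ → E) (x : ℝ) : E :=
  derivWithin f (Icc 0 1) x

/-- `H²`-immersed plane curves: `γ ∈ H²(I; ℝ²)` with `γ'` nowhere zero on `[0,1]`
(equivalently `min |γ'| > 0`, as `γ'` is continuous on `[0,1]`). -/
def IsImmersedH2 (γ : ℝ → Plane) : Prop :=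
  MemH2 γ ∧ ∀ x ∈ Icc (0 : ℝ) 1, dx γ x ≠ 0

/-- The length `L[γ] = ∫_I |γ'| dx`. -/
noncomputable def length (γ : ℝ → Plane) : ℝ :=
  ∫ x in Ioo (0 : ℝ) 1, ‖dx γ x‖

/-- The derivative `∂_s f = |γ'|⁻¹ f'` of `f` with respect to the arclength of `γ`. -/
noncomputable def ds {E : Type*} [NormedAddCommGroup E] [NormedSpace ℝ E]
    (γ : ℝ → Plane) (f : ℝ → E) (x : ℝ) : E :=
  ‖dx γ x‖⁻¹ • dx f x

/-- The unit tangent `∂_s γ`. -/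
noncomputable def tangent (γ : ℝ → Plane) : ℝ → Plane := ds γ γ

/-- The curvature vector `κ = ∂_s (∂_s γ)`, defined almost everywhere. -/
noncomputable def curvature (γ : ℝ → Plane) : ℝ → Plane := ds γ (tangent γ)

/-- The bending energy `B[γ] = ∫_γ |κ|² ds`, as an element of `[0, ∞]`. -/
noncomputable def bending (γ : ℝ → Plane) : ℝ≥0∞ :=
  ∫⁻ x in Ioo (0 : ℝ) 1, ENNReal.ofReal (‖curvature γ x‖ ^ 2 * ‖dx γ x‖)

/-- `θ ∈ H¹(I)` is a tangential angle function of `γ`: `∂_s γ = (cos θ, sin θ)` on `[0,1]`.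
It is unique up to an additive constant in `2πℤ`. -/
def IsTangentAngle (γ : ℝ → Plane) (θ : ℝ → ℝ) : Prop :=
  MemH1 θ ∧ ∀ x ∈ Icc (0 : ℝ) 1, tangent γ x = !₂[Real.cos (θ x), Real.sin (θ x)]

/-- `TC[γ] = τ`: the total signed curvature `∫_γ k ds`, with `k = ∂_s θ` for a tangential angle
function `θ` of `γ`, equals `τ`. The value does not depend on the choice of `θ`. -/
def HasTotalCurvature (γ : ℝ → Plane) (τ : ℝ) : Prop :=
  ∃ θ : ℝ → ℝ, IsTangentAngle γ θ ∧ ∫ x in Ioo (0 : ℝ) 1, ds γ θ x * ‖dx γ x‖ = τ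

/-- The class `A_ℓ` of immersed `H²` plane curves of length `1` from `(0,0)` to `(ℓ,0)`. -/
def curves (ℓ : ℝ) : Set (ℝ → Plane) :=
  {γ | IsImmersedH2 γ ∧ γ 0 = !₂[0, 0] ∧ γ 1 = !₂[ℓ, 0] ∧ length γ = 1}

/-- The class `A'_ℓ` of curves in `A_ℓ` with zero total curvature. -/
def balancedCurves (ℓ : ℝ) : Set (ℝ → Plane) :=
  {γ | γ ∈ curves ℓ ∧ HasTotalCurvature γ 0}

/-- `ϖ* = inf_{γ ∈ A_0} B[γ]`. -/
noncomputable def varpiStar : ℝ≥0∞ := ⨅ γ ∈ curves 0, bending γ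

end PinnedCurve

/-! A closed `C¹` curve with zero total curvature must cross itself. Cutting it at a crossing gives
two loops, closed in position but not necessarily in tangent, so after rescaling each is an
admissible curve for `ϖ*`. Length times energy is scale invariant; hence `ϖ* ≤ Lᵢ Eᵢ` for both loops
(`varpiStar_le`, `varpiStar_le_arc`), and the arithmetic-geometric mean inequality gives `4 ϖ* ≤ (L₁
+ L₂)(E₁ + E₂)` (`four_mul_varpiStar_le`).

The crossing comes from Hopf's argument for the rotation number (`exists_integral_eq_zero`). Without
a crossing, the chord direction, extended by the tangent, has a continuous logarithm on a simply
connected set of chords. Going from the tangent at `0` to the tangent at `1` through chords takes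
two equal half-turns, that is, an odd multiple of `2π`. Going along the tangents gives zero.

For `ℓ > 0` the curve is first closed up without touching its tangent angle: the unit speed is
replaced by `V(θ) = 1 + a cos θ + b sin θ`. The total curvature stays zero and the energy density
becomes `k² / V`. Closing is a `2 × 2` linear system for `a, b`, whose matrix is the second moment
matrix of the tangent. A nearly closed curve of energy at most `c` cannot keep its tangent close to
one line, so this matrix is bounded below in terms of `c` alone (`le_integral_sq_of_unit`) and `a, b
= O(ℓ)`. Thus energy at most `c` forces `4 ϖ* ≤ (1 + δ) c / (1 - δ)` with `δ = O(ℓ)`, which is false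
for small `ℓ` when `c < 4 ϖ*`. No compactness or minimizer is needed. -/

namespace PinnedCurve

variable {E : Type*} [NormedAddCommGroup E] [NormedSpace ℝ E]

/-! ### Indefinite integrals and absolute continuity -/

/-- On `[0,1]` the function `f` is an indefinite integral of the integrable function `g`. -/
def IsPrimitive (f g : ℝ → E) : Prop :=
  IntervalIntegrable g volume 0 1 ∧ ∀ x ∈ Icc (0 : ℝ) 1, f x = f 0 + ∫ t in (0 : ℝ)..x, g t

theorem intervalIntegrable_unit_iff {F : Type*} [NormedAddCommGroup F] {g : ℝ → F} :
    IntervalIntegrable g volume 0 1 ↔ Integrable g (volume.restrict (Ioo (0 : ℝ) 1)) :=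
  intervalIntegrable_iff_integrableOn_Ioo_of_le zero_le_one

theorem integral_unit (g : ℝ → E) :
    ∫ x in Ioo (0 : ℝ) 1, g x = ∫ x in (0 : ℝ)..1, g x := by
  rw [intervalIntegral.integral_of_le zero_le_one, integral_Ioc_eq_integral_Ioo]

theorem MemL2.intervalIntegrable {F : Type*} [NormedAddCommGroup F] {g : ℝ → F} (hg : MemL2 g) :
    IntervalIntegrable g volume 0 1 :=
  intervalIntegrable_unit_iff.2 (MemLp.integrable (by norm_num) hg)

/-- Transfers absolute continuity between different target spaces: to a vector-valued primitive from
the primitive of the norm, and to a composite from its inner function. -/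
theorem _root_.AbsolutelyContinuousOnInterval.of_dist_le {X Y : Type*} [PseudoMetricSpace X]
    [PseudoMetricSpace Y] {f : ℝ → X} {g : ℝ → Y} {a b K : ℝ}
    (hg : AbsolutelyContinuousOnInterval g a b)
    (h : ∀ x ∈ uIcc a b, ∀ y ∈ uIcc a b, dist (f x) (f y) ≤ K * dist (g x) (g y)) :
    AbsolutelyContinuousOnInterval f a b := by
  have h1 := Tendsto.const_mul K hg
  rw [mul_zero] at h1
  refine squeeze_zero' (Eventually.of_forall fun _ => Finset.sum_nonneg fun _ _ => dist_nonneg) ?_ h1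
  rw [eventually_inf_principal]
  refine Eventually.of_forall fun ⟨n, I⟩ hI => ?_
  rw [Finset.mul_sum]
  exact Finset.sum_le_sum fun i hi => h _ (hI.1 i hi).1 _ (hI.1 i hi).2

theorem _root_.AbsolutelyContinuousOnInterval.contDiff_comp {P : ℝ → E} (hP : ContDiff ℝ 1 P)
    {θ : ℝ → ℝ} {a b : ℝ} (hθ : AbsolutelyContinuousOnInterval θ a b) :
    AbsolutelyContinuousOnInterval (fun x => P (θ x)) a b := by
  obtain ⟨C, hC⟩ := hθ.exists_bound
  obtain ⟨K, hK⟩ := hP.contDiffOn.exists_lipschitzOnWith (s := Icc (-C) C) (by decide)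
    (convex_Icc _ _) isCompact_Icc
  exact hθ.of_dist_le fun x hx y hy => hK.dist_le_mul _ (abs_le.1 (hC x hx)) _ (abs_le.1 (hC y hy))

theorem IsPrimitive.sub_eq {f g : ℝ → E} (h : IsPrimitive f g) {x y : ℝ}
    (hx : x ∈ Icc (0 : ℝ) 1) (hy : y ∈ Icc (0 : ℝ) 1) : f y - f x = ∫ t in x..y, g t := by
  have h0 : (0 : ℝ) ∈ Icc (0 : ℝ) 1 := ⟨le_rfl, zero_le_one⟩
  have hI : ∀ z ∈ Icc (0 : ℝ) 1, IntervalIntegrable g volume 0 z := fun z hz =>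
    h.1.mono_set (by
      rw [uIcc_of_le hz.1, uIcc_of_le zero_le_one]; exact Icc_subset_Icc le_rfl hz.2)
  rw [h.2 x hx, h.2 y hy, ← intervalIntegral.integral_interval_sub_left (hI y hy) (hI x hx)]
  abel

theorem IsPrimitive.absolutelyContinuous {f g : ℝ → E} (h : IsPrimitive f g) :
    AbsolutelyContinuousOnInterval f 0 1 := by
  have hn := h.1.norm
  have hA := hn.absolutelyContinuousOnInterval_intervalIntegral (c := 0) (by simp)
  refine hA.of_dist_le (K := 1) fun x hx y hy => ?_
  rw [uIcc_of_le zero_le_one] at hx hy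
  have hI : ∀ z ∈ Icc (0 : ℝ) 1, IntervalIntegrable (fun t => ‖g t‖) volume 0 z := fun z hz =>
    hn.mono_set (by
      rw [uIcc_of_le hz.1, uIcc_of_le zero_le_one]; exact Icc_subset_Icc le_rfl hz.2)
  rw [one_mul, dist_eq_norm, h.sub_eq hy hx, Real.dist_eq,
    intervalIntegral.integral_interval_sub_left (hI x hx) (hI y hy)]
  exact intervalIntegral.norm_integral_le_abs_integral_norm

theorem IsPrimitive.continuousOn {f g : ℝ → E} (h : IsPrimitive f g) :
    ContinuousOn f (Icc 0 1) := by
  simpa [uIcc_of_le] using h.absolutelyContinuous.continuousOn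

theorem IsPrimitive.ae_hasDerivAt [CompleteSpace E] {f g : ℝ → E} (h : IsPrimitive f g) :
    ∀ᵐ x, x ∈ Ioo (0 : ℝ) 1 → HasDerivAt f (g x) x := by
  filter_upwards [h.1.ae_hasDerivAt_integral] with x hx hx1
  have h2 := (hx (by rw [uIcc_of_le zero_le_one]; exact Ioo_subset_Icc_self hx1) 0
    (by simp)).const_add (f 0)
  refine h2.congr_of_eventuallyEq ?_
  filter_upwards [Ioo_mem_nhds hx1.1 hx1.2] with y hy
  exact h.2 y (Ioo_subset_Icc_self hy)

/-- The difference of `f` and the integral of `g` is absolutely continuous with derivative zero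
almost everywhere, hence constant. -/
theorem isPrimitive_of_ae_hasDerivAt [CompleteSpace E] {f g : ℝ → E}
    (hf : AbsolutelyContinuousOnInterval f 0 1) (hg : IntervalIntegrable g volume 0 1)
    (h : ∀ᵐ x, x ∈ Ioo (0 : ℝ) 1 → HasDerivAt f (g x) x) : IsPrimitive f g := by
  have hG : IsPrimitive (fun x => ∫ t in (0 : ℝ)..x, g t) g := ⟨hg, fun x _ => by simp⟩
  have hd : ∀ᵐ x, x ∈ uIcc (0 : ℝ) 1 →
      HasDerivAt (fun x => f x - ∫ t in (0 : ℝ)..x, g t) 0 x := by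
    have h0 : ∀ᵐ x : ℝ, x ≠ 0 := by simp [ae_iff, measure_singleton]
    have h1 : ∀ᵐ x : ℝ, x ≠ 1 := by simp [ae_iff, measure_singleton]
    filter_upwards [h, hG.ae_hasDerivAt, h0, h1] with x hx hx' n0 n1 hm
    rw [uIcc_of_le zero_le_one] at hm
    have hm' : x ∈ Ioo (0 : ℝ) 1 := ⟨lt_of_le_of_ne hm.1 n0.symm, lt_of_le_of_ne hm.2 n1⟩
    have hs := (hx hm').fun_sub (hx' hm')
    rwa [sub_self] at hs
  obtain ⟨C, hC⟩ := (hf.fun_sub hG.absolutelyContinuous).const_of_ae_hasDerivAt_zero hd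
  refine ⟨hg, fun x hx => ?_⟩
  have e1 := hC x (by rwa [uIcc_of_le zero_le_one])
  have e0 := hC 0 (by simp)
  simp only [intervalIntegral.integral_same, sub_zero] at e0
  rw [e0, ← e1]; abel

theorem IsPrimitive.contDiff_comp [CompleteSpace E] {P : ℝ → E} (hP : ContDiff ℝ 1 P)
    {θ k : ℝ → ℝ} (h : IsPrimitive θ k) :
    IsPrimitive (fun x => P (θ x)) (fun x => k x • deriv P (θ x)) := by
  refine isPrimitive_of_ae_hasDerivAt (h.absolutelyContinuous.contDiff_comp hP) ?_ ?_
  · refine h.1.smul_continuousOn ?_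
    rw [uIcc_of_le zero_le_one]
    exact (hP.continuous_deriv (by norm_num)).comp_continuousOn h.continuousOn
  · filter_upwards [h.ae_hasDerivAt] with x hx hm
    exact ((hP.differentiable (by norm_num)) (θ x)).hasDerivAt.scomp x (hx hm)

/-! ### Primitives and weak derivatives -/

theorem IsPrimitive.memL2 {f g : ℝ → E} (h : IsPrimitive f g) : MemL2 f := by
  obtain ⟨C, hC⟩ := isCompact_Icc.exists_bound_of_continuousOn h.continuousOn
  refine MemLp.of_bound ((h.continuousOn.mono Ioo_subset_Icc_self).aestronglyMeasurable
    measurableSet_Ioo) C ?_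
  filter_upwards [ae_restrict_mem measurableSet_Ioo] with x hx
  exact hC x (Ioo_subset_Icc_self hx)

theorem IsPrimitive.hasWeakDeriv [CompleteSpace E] {f g : ℝ → E} (h : IsPrimitive f g) :
    HasWeakDeriv f g := by
  have hfi : IntegrableOn f (Ioo 0 1) volume :=
    intervalIntegrable_unit_iff.1 h.memL2.intervalIntegrable
  have hgi : IntegrableOn g (Ioo 0 1) volume := intervalIntegrable_unit_iff.1 h.1
  refine ⟨hfi.locallyIntegrableOn, hgi.locallyIntegrableOn, ?_⟩
  intro φ hφ hc hs
  have hφ1 : ContDiff ℝ 1 φ := hφ.of_le (by exact_mod_cast le_top)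
  have i1 : IntervalIntegrable (fun x => deriv φ x • f x) volume 0 1 := by
    refine ContinuousOn.intervalIntegrable ?_
    rw [uIcc_of_le zero_le_one]
    exact (hφ1.continuous_deriv (by norm_num)).continuousOn.smul h.continuousOn
  have i2 : IntervalIntegrable (fun x => φ x • g x) volume 0 1 :=
    h.1.continuousOn_smul hφ.continuous.continuousOn
  have hp : IsPrimitive (fun x => φ x • f x) (fun x => deriv φ x • f x + φ x • g x) := by
    refine isPrimitive_of_ae_hasDerivAt ?_ (i1.add i2) ?_
    · exact (hφ1.contDiffOn.absolutelyContinuousOnInterval).fun_smul h.absolutelyContinuous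
    · filter_upwards [h.ae_hasDerivAt] with x hx hm
      have := (hφ1.differentiable (by norm_num) x).hasDerivAt.smul (hx hm)
      rwa [add_comm] at this
  have e := hp.2 1 ⟨zero_le_one, le_rfl⟩
  have z0 : φ 0 = 0 := image_eq_zero_of_notMem_tsupport fun h => lt_irrefl _ (hs h).1
  have z1 : φ 1 = 0 := image_eq_zero_of_notMem_tsupport fun h => lt_irrefl _ (hs h).2
  simp only [z0, z1, zero_smul, zero_add] at e
  rw [intervalIntegral.integral_add i1 i2] at e
  rw [integral_unit, integral_unit]
  exact eq_neg_of_add_eq_zero_left e.symm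

/-- The du Bois-Reymond lemma. A test function of mean zero is the derivative of a test function;
any `ψ` becomes one after subtracting a multiple of a fixed bump `η` of mass one, so `f` tests like
the constant `∫ η f`. -/
theorem exists_ae_eq_const_of_integral_deriv_smul_eq_zero [CompleteSpace E] {f : ℝ → E}
    (hf : LocallyIntegrableOn f (Ioo 0 1) volume)
    (h : ∀ φ : ℝ → ℝ, ContDiff ℝ ∞ φ → HasCompactSupport φ → tsupport φ ⊆ Ioo 0 1 →
      ∫ x in Ioo (0 : ℝ) 1, deriv φ x • f x = 0) :
    ∃ c : E, ∀ᵐ x, x ∈ Ioo (0 : ℝ) 1 → f x = c := by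
  let b : ContDiffBump (1 / 2 : ℝ) := ⟨1 / 8, 1 / 4, by norm_num, by norm_num⟩
  let η : ℝ → ℝ := b.normed volume
  have hη : ContDiff ℝ ∞ η := b.contDiff_normed
  have hηc : HasCompactSupport η := b.hasCompactSupport_normed
  have hηs : tsupport η = Metric.closedBall (1 / 2 : ℝ) (1 / 4) := b.tsupport_normed_eq
  have hηs' : tsupport η ⊆ Ioo 0 1 := by
    rw [hηs, Real.closedBall_eq_Icc]
    intro x hx
    constructor <;> linarith [hx.1, hx.2]
  have hη1 : ∫ x, η x = 1 := b.integral_normed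
  have hint : ∀ (ψ : ℝ → ℝ) (u : ℝ → E), Continuous ψ → HasCompactSupport ψ →
      tsupport ψ ⊆ Ioo 0 1 → LocallyIntegrableOn u (Ioo 0 1) volume →
      Integrable (fun x => ψ x • u x) volume := by
    intro ψ u hψ hc hs hu
    have hK : IntegrableOn (fun x => ψ x • u x) (tsupport ψ) volume :=
      (hu.integrableOn_compact_subset hs hc).continuousOn_smul hψ.continuousOn hc
    refine hK.integrable_of_forall_notMem_eq_zero fun x hx => ?_
    rw [image_eq_zero_of_notMem_tsupport hx, zero_smul]
  set c : E := ∫ x, η x • f x with hcdef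
  have hcl : LocallyIntegrableOn (fun _ : ℝ => c) (Ioo 0 1) volume :=
    (locallyIntegrable_const c).locallyIntegrableOn _
  refine ⟨c, ?_⟩
  have key := isOpen_Ioo.ae_eq_zero_of_integral_contDiff_smul_eq_zero (hf.sub hcl) (by
    intro ψ hψ hψc hψs
    set m : ℝ := ∫ x, ψ x with hm
    set ρ : ℝ → ℝ := fun x => ψ x - m * η x with hρ
    have hρd : ContDiff ℝ ∞ ρ := hψ.sub (contDiff_const.mul hη)
    have hρc : Continuous ρ := hρd.continuous
    have hψi : Integrable ψ volume := hψ.continuous.integrable_of_hasCompactSupport hψc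
    have hηi : Integrable η volume := hη.continuous.integrable_of_hasCompactSupport hηc
    have hρ0 : ∫ x, ρ x = 0 := by
      rw [hρ, integral_sub hψi (hηi.const_mul m), integral_const_mul, hη1, mul_one, sub_self]
    set K := tsupport ψ ∪ tsupport η with hK
    have hKc : IsCompact K := hψc.isCompact.union hηc
    have hKs : K ⊆ Ioo 0 1 := union_subset hψs hηs'
    have hKn : K.Nonempty :=
      ⟨1 / 2, Or.inr (by rw [hηs]; exact Metric.mem_closedBall_self (by norm_num))⟩
    obtain ⟨p, hpK, hp⟩ := hKc.exists_isLeast hKn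
    obtain ⟨q, hqK, hq⟩ := hKc.exists_isGreatest hKn
    have hρK : ∀ x, x ∉ K → ρ x = 0 := by
      intro x hx
      have h1 : x ∉ tsupport ψ := fun h => hx (Or.inl h)
      have h2 : x ∉ tsupport η := fun h => hx (Or.inr h)
      simp [hρ, image_eq_zero_of_notMem_tsupport h1, image_eq_zero_of_notMem_tsupport h2]
    have hρcs : HasCompactSupport ρ := HasCompactSupport.intro hKc hρK
    have hρi : Integrable ρ volume := hρc.integrable_of_hasCompactSupport hρcs
    set φ : ℝ → ℝ := fun x => ∫ t in (0 : ℝ)..x, ρ t with hφ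
    have hφd : ∀ x, HasDerivAt φ (ρ x) x := fun x =>
      intervalIntegral.integral_hasDerivAt_right (hρc.intervalIntegrable _ _)
        (hρc.stronglyMeasurableAtFilter _ _) hρc.continuousAt
    have hφ' : deriv φ = ρ := funext fun x => (hφd x).deriv
    have hφC : ContDiff ℝ ∞ φ :=
      contDiff_infty_iff_deriv.2 ⟨fun x => (hφd x).differentiableAt, by rwa [hφ']⟩
    -- The primitive vanishes to the left of the support of `ρ` trivially, and to the right because
    -- `ρ` has mean zero.
    have hz : ∀ x, x ∉ Icc p q → φ x = 0 := by
      intro x hx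
      have h0p : 0 < p := (hKs hpK).1
      have hneg : ∀ t, t < p → ρ t = 0 := fun t ht => hρK t fun h => absurd (hp h) (not_le.2 ht)
      have hpos : ∀ t, q < t → ρ t = 0 := fun t ht => hρK t fun h => absurd (hq h) (not_le.2 ht)
      rcases lt_or_ge x p with h1 | h1
      · have : EqOn ρ (fun _ => 0) (uIcc 0 x) := by
          intro t ht
          refine hneg t (lt_of_le_of_lt ht.2 (max_lt h0p h1))
        simp only [hφ]
        rw [intervalIntegral.integral_congr this]; simp
      · have h2 : q < x := by
          by_contra h3
          exact hx ⟨h1, not_lt.1 h3⟩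
        have h0x : 0 ≤ x := h0p.le.trans h1
        simp only [hφ]
        rw [intervalIntegral.integral_of_le h0x, setIntegral_eq_integral_of_forall_compl_eq_zero, hρ0]
        intro t ht
        rcases le_or_gt t 0 with h4 | h4
        · exact hneg t (lt_of_le_of_lt h4 h0p)
        · refine hpos t (h2.trans ?_)
          by_contra h5
          exact ht ⟨h4, not_lt.1 h5⟩
    have hφsub : tsupport φ ⊆ Icc p q :=
      closure_minimal (fun x hx => by by_contra h; exact hx (hz x h)) isClosed_Icc
    have e := h φ hφC (HasCompactSupport.intro isCompact_Icc hz)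
      (hφsub.trans fun x hx => ⟨(hKs hpK).1.trans_le hx.1, hx.2.trans_lt (hKs hqK).2⟩)
    have hρs : tsupport ρ ⊆ Ioo 0 1 :=
      (closure_minimal (fun x hx => by by_contra h; exact hx (hρK x h)) hKc.isClosed).trans hKs
    rw [hφ', setIntegral_eq_integral_of_forall_compl_eq_zero (fun x hx => by
      rw [image_eq_zero_of_notMem_tsupport fun h => hx (hρs h), zero_smul])] at e
    have iψ := hint ψ f hψ.continuous hψc hψs hf
    have iη := hint η f hη.continuous hηc hηs' hf
    have e2 : ∫ x, ρ x • f x = (∫ x, ψ x • f x) - m • c := by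
      simp only [hρ, sub_smul, mul_smul]
      rw [integral_sub iψ (iη.fun_smul m), integral_smul]
    simp only [Pi.sub_apply, smul_sub]
    rw [integral_sub iψ (hint ψ _ hψ.continuous hψc hψs hcl), integral_smul_const, ← hm, ← e2, e])
  filter_upwards [key] with x hx hm
  exact sub_eq_zero.1 (hx hm)

theorem exists_ae_eq_const_add_integral [CompleteSpace E] {f g : ℝ → E}
    (hg : IntervalIntegrable g volume 0 1) (h : HasWeakDeriv f g) :
    ∃ c : E, ∀ᵐ x, x ∈ Ioo (0 : ℝ) 1 → f x = c + ∫ t in (0 : ℝ)..x, g t := by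
  have hG : IsPrimitive (fun x => ∫ t in (0 : ℝ)..x, g t) g := ⟨hg, fun x _ => by simp⟩
  obtain ⟨w1, w2, w3⟩ := hG.hasWeakDeriv
  obtain ⟨c, hc⟩ := exists_ae_eq_const_of_integral_deriv_smul_eq_zero
    (f := fun x => f x - ∫ t in (0 : ℝ)..x, g t) (h.1.sub w1) (by
      intro φ hφ hc hs
      have hφ1 : ContDiff ℝ 1 φ := hφ.of_le (by exact_mod_cast le_top)
      have hcd : Continuous (deriv φ) := hφ1.continuous_deriv (by norm_num)
      have hI : ∀ u : ℝ → E, LocallyIntegrableOn u (Ioo 0 1) volume →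
          Integrable (fun x => deriv φ x • u x) (volume.restrict (Ioo (0 : ℝ) 1)) := by
        intro u hu
        have hK : IntegrableOn (fun x => deriv φ x • u x) (tsupport φ) volume :=
          (hu.integrableOn_compact_subset hs hc).continuousOn_smul hcd.continuousOn hc
        refine (hK.integrable_of_forall_notMem_eq_zero fun x hx => ?_).integrableOn
        have : deriv φ x = 0 := by
          by_contra hne
          exact hx (support_deriv_subset hne)
        rw [this, zero_smul]
      simp_rw [smul_sub]
      rw [integral_sub (hI _ h.1) (hI _ w1), h.2.2 φ hφ hc hs, w3 φ hφ hc hs, sub_self])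
  refine ⟨c, ?_⟩
  filter_upwards [hc] with x hx hm
  rw [← hx hm]; abel

theorem HasWeakDeriv.isPrimitive [CompleteSpace E] {f g : ℝ → E} (hf : ContinuousOn f (Icc 0 1))
    (hg : IntervalIntegrable g volume 0 1) (h : HasWeakDeriv f g) : IsPrimitive f g := by
  obtain ⟨c, hc⟩ := exists_ae_eq_const_add_integral hg h
  have hG : IsPrimitive (fun x => c + ∫ t in (0 : ℝ)..x, g t) g := ⟨hg, fun x _ => by simp⟩
  have he : EqOn f (fun x => c + ∫ t in (0 : ℝ)..x, g t) (Icc 0 1) := by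
    have h1 : EqOn f (fun x => c + ∫ t in (0 : ℝ)..x, g t) (Ioo 0 1) :=
      Measure.eqOn_open_of_ae_eq (μ := volume) ((ae_restrict_iff' measurableSet_Ioo).2 hc) isOpen_Ioo
        (hf.mono Ioo_subset_Icc_self) (hG.continuousOn.mono Ioo_subset_Icc_self)
    refine h1.of_subset_closure hf hG.continuousOn Ioo_subset_Icc_self ?_
    rw [closure_Ioo zero_ne_one]
  refine ⟨hg, fun x hx => ?_⟩
  rw [he hx, he (⟨le_rfl, zero_le_one⟩ : (0 : ℝ) ∈ Icc (0 : ℝ) 1)]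
  simp

/-! ### Tangent angles, pointwise derivatives and the energy density -/

/-- The unit vector at angle `τ`. -/
noncomputable def unitVec (τ : ℝ) : Plane := !₂[Real.cos τ, Real.sin τ]

theorem unitVec_eq (τ : ℝ) :
    unitVec τ = Real.cos τ • (!₂[1, 0] : Plane) + Real.sin τ • (!₂[0, 1] : Plane) := by
  ext i; fin_cases i <;> simp [unitVec]

theorem norm_unitVec (τ : ℝ) : ‖unitVec τ‖ = 1 := by
  simp [unitVec, EuclideanSpace.norm_eq, Fin.sum_univ_two]

theorem contDiff_unitVec {n : WithTop ℕ∞} : ContDiff ℝ n unitVec := by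
  have : unitVec = fun τ => Real.cos τ • (!₂[1, 0] : Plane) + Real.sin τ • (!₂[0, 1] : Plane) :=
    funext unitVec_eq
  rw [this]
  exact (Real.contDiff_cos.smul contDiff_const).add (Real.contDiff_sin.smul contDiff_const)

theorem hasDerivAt_unitVec (τ : ℝ) : HasDerivAt unitVec (unitVec (τ + Real.pi / 2)) τ := by
  have : unitVec = fun τ => Real.cos τ • (!₂[1, 0] : Plane) + Real.sin τ • (!₂[0, 1] : Plane) :=
    funext unitVec_eq
  rw [this]
  simp only [Real.cos_add_pi_div_two, Real.sin_add_pi_div_two]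
  exact ((Real.hasDerivAt_cos τ).smul_const _).add ((Real.hasDerivAt_sin τ).smul_const _)

/-- Extension of a function on `[0,1]` to the line by its boundary values. -/
noncomputable def clampExt {F : Type*} (f : ℝ → F) (x : ℝ) : F := f (projIcc 0 1 zero_le_one x)

theorem clampExt_eq {F : Type*} {f : ℝ → F} {x : ℝ} (hx : x ∈ Icc (0 : ℝ) 1) : clampExt f x = f x := by
  rw [clampExt, projIcc_of_mem zero_le_one hx]

theorem continuous_clampExt {F : Type*} [TopologicalSpace F] {f : ℝ → F} (hf : ContinuousOn f (Icc 0 1)) :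
    Continuous (clampExt f) :=
  (continuousOn_iff_continuous_domRestrict.1 hf).comp continuous_projIcc

theorem IsPrimitive.congr {f g g' : ℝ → E} (h : IsPrimitive f g)
    (he : ∀ᵐ x, x ∈ Ioo (0 : ℝ) 1 → g x = g' x) : IsPrimitive f g' := by
  have h1 : ∀ᵐ x : ℝ, x ≠ 1 := by simp [ae_iff, measure_singleton]
  have he' : ∀ᵐ x, x ∈ Ioc (0 : ℝ) 1 → g x = g' x := by
    filter_upwards [he, h1] with x hx n1 hm
    exact hx ⟨hm.1, lt_of_le_of_ne hm.2 n1⟩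
  refine ⟨h.1.congr_ae (by
    rw [uIoc_of_le zero_le_one]; exact (ae_restrict_iff' measurableSet_Ioc).2 he'), fun x hx => ?_⟩
  rw [h.2 x hx]
  congr 1
  refine intervalIntegral.integral_congr_ae ?_
  filter_upwards [he'] with t ht hm
  rw [uIoc_of_le hx.1] at hm
  exact ht ⟨hm.1, hm.2.trans hx.2⟩

/-- Extending `g` continuously to the line makes the two-sided fundamental theorem available at the
endpoints as well. -/
theorem IsPrimitive.hasDerivWithinAt [CompleteSpace E] {f g : ℝ → E} (h : IsPrimitive f g)
    (hg : ContinuousOn g (Icc 0 1)) {x : ℝ} (hx : x ∈ Icc (0 : ℝ) 1) :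
    HasDerivWithinAt f (g x) (Icc 0 1) x := by
  have hc := continuous_clampExt hg
  have hd : HasDerivAt (fun x => f 0 + ∫ t in (0 : ℝ)..x, clampExt g t) (clampExt g x) x :=
    (intervalIntegral.integral_hasDerivAt_right (hc.intervalIntegrable _ _)
      (hc.stronglyMeasurableAtFilter _ _) hc.continuousAt).const_add _
  rw [clampExt_eq hx] at hd
  have he : ∀ y ∈ Icc (0 : ℝ) 1, f y = f 0 + ∫ t in (0 : ℝ)..y, clampExt g t := by
    intro y hy
    rw [h.2 y hy]
    congr 1
    refine intervalIntegral.integral_congr fun t ht => ?_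
    rw [uIcc_of_le hy.1] at ht
    exact (clampExt_eq ⟨ht.1, ht.2.trans hy.2⟩).symm
  exact hd.hasDerivWithinAt.congr he (he x hx)

theorem dx_eq_of_hasDerivWithinAt {f : ℝ → E} {v : E} {x : ℝ} (hx : x ∈ Icc (0 : ℝ) 1)
    (h : HasDerivWithinAt f v (Icc 0 1) x) : dx f x = v :=
  h.derivWithin (uniqueDiffOn_Icc zero_lt_one x hx)

theorem IsPrimitive.dx_eq [CompleteSpace E] {f g : ℝ → E} (h : IsPrimitive f g)
    (hg : ContinuousOn g (Icc 0 1)) {x : ℝ} (hx : x ∈ Icc (0 : ℝ) 1) : dx f x = g x :=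
  dx_eq_of_hasDerivWithinAt hx (h.hasDerivWithinAt hg hx)

theorem IsPrimitive.ae_dx_eq [CompleteSpace E] {f g : ℝ → E} (h : IsPrimitive f g) :
    ∀ᵐ x, x ∈ Ioo (0 : ℝ) 1 → dx f x = g x := by
  filter_upwards [h.ae_hasDerivAt] with x hx hm
  exact dx_eq_of_hasDerivWithinAt (Ioo_subset_Icc_self hm) (hx hm).hasDerivWithinAt

theorem MemH1.exists_isPrimitive [CompleteSpace E] {f : ℝ → E} (h : MemH1 f) :
    ∃ g, MemL2 g ∧ IsPrimitive f g := by
  obtain ⟨hc, -, g, hg, hw⟩ := h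
  exact ⟨g, hg, hw.isPrimitive hc hg.intervalIntegrable⟩

theorem MemH2.exists_isPrimitive [CompleteSpace E] {f : ℝ → E} (h : MemH2 f) :
    ∃ p g, MemL2 g ∧ IsPrimitive f p ∧ IsPrimitive p g := by
  obtain ⟨hc, -, f₁, f₂, h1, h2, hw1, hw2⟩ := h
  obtain ⟨c, hc2⟩ := exists_ae_eq_const_add_integral h2.intervalIntegrable hw2
  exact ⟨fun x => c + ∫ t in (0 : ℝ)..x, f₂ t, f₂, h2,
    (hw1.isPrimitive hc h1.intervalIntegrable).congr hc2, h2.intervalIntegrable, fun x _ => by simp⟩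

/-- The squared curvature density of a curve with tangent angle `θ`, where `θ' = k`. -/
theorem ae_bending_density {γ : ℝ → Plane} {θ k : ℝ → ℝ} (hθ : IsPrimitive θ k)
    (hne : ∀ x ∈ Icc (0 : ℝ) 1, dx γ x ≠ 0)
    (ht : ∀ x ∈ Icc (0 : ℝ) 1, tangent γ x = unitVec (θ x)) :
    ∀ᵐ x, x ∈ Ioo (0 : ℝ) 1 → ‖curvature γ x‖ ^ 2 * ‖dx γ x‖ = k x ^ 2 / ‖dx γ x‖ := by
  filter_upwards [hθ.ae_hasDerivAt] with x hx hm
  have hxI := Ioo_subset_Icc_self hm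
  have hd : HasDerivWithinAt (tangent γ) (k x • unitVec (θ x + Real.pi / 2)) (Icc 0 1) x :=
    ((hasDerivAt_unitVec (θ x)).scomp x (hx hm)).hasDerivWithinAt.congr ht (ht x hxI)
  have hn : ‖dx γ x‖ ≠ 0 := norm_ne_zero_iff.2 (hne x hxI)
  rw [curvature, ds, dx_eq_of_hasDerivWithinAt hxI hd, norm_smul, norm_smul, norm_unitVec, norm_inv,
    norm_norm, mul_one, Real.norm_eq_abs, mul_pow, sq_abs]
  field_simp

theorem bending_eq_lintegral {γ : ℝ → Plane} {θ k : ℝ → ℝ} (hθ : IsPrimitive θ k)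
    (hne : ∀ x ∈ Icc (0 : ℝ) 1, dx γ x ≠ 0)
    (ht : ∀ x ∈ Icc (0 : ℝ) 1, tangent γ x = unitVec (θ x)) :
    bending γ = ∫⁻ x in Ioo (0 : ℝ) 1, ENNReal.ofReal (k x ^ 2 / ‖dx γ x‖) := by
  refine lintegral_congr_ae ((ae_restrict_iff' measurableSet_Ioo).2 ?_)
  filter_upwards [ae_bending_density hθ hne ht] with x hx hm
  rw [hx hm]

theorem MemL2.integrable_sq_div {k σ : ℝ → ℝ} (hk : MemL2 k) (hσ : ContinuousOn σ (Icc 0 1))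
    (hpos : ∀ x ∈ Icc (0 : ℝ) 1, 0 < σ x) :
    IntervalIntegrable (fun x => k x ^ 2 / σ x) volume 0 1 := by
  have h1 : IntervalIntegrable (fun x => k x ^ 2) volume 0 1 :=
    intervalIntegrable_unit_iff.2 ((memLp_two_iff_integrable_sq hk.aestronglyMeasurable).1 hk)
  simp_rw [div_eq_mul_inv]
  refine h1.mul_continuousOn ?_
  rw [uIcc_of_le zero_le_one]
  exact hσ.inv₀ fun x hx => (hpos x hx).ne'

theorem bending_eq {γ : ℝ → Plane} {θ k : ℝ → ℝ} (hk : MemL2 k) (hθ : IsPrimitive θ k)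
    (hc : ContinuousOn (fun x => ‖dx γ x‖) (Icc 0 1))
    (hne : ∀ x ∈ Icc (0 : ℝ) 1, dx γ x ≠ 0)
    (ht : ∀ x ∈ Icc (0 : ℝ) 1, tangent γ x = unitVec (θ x)) :
    bending γ = ENNReal.ofReal (∫ x in (0 : ℝ)..1, k x ^ 2 / ‖dx γ x‖) := by
  rw [bending_eq_lintegral hθ hne ht, ← integral_unit, ofReal_integral_eq_lintegral_ofReal]
  · exact intervalIntegrable_unit_iff.1
      (hk.integrable_sq_div hc fun x hx => norm_pos_iff.2 (hne x hx))
  · exact Eventually.of_forall fun x => div_nonneg (sq_nonneg _) (norm_nonneg _)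

/-! ### Arclength parametrization -/

/-- Reparametrization of `[0,1]` by a positive continuous speed of total mass `1`. -/
theorem exists_arclength_reparam {θ k σ : ℝ → ℝ} (hσ : ContinuousOn σ (Icc 0 1))
    (hpos : ∀ x ∈ Icc (0 : ℝ) 1, 0 < σ x) (h1 : ∫ x in (0 : ℝ)..1, σ x = 1)
    (hk : MemL2 k) (hθ : IsPrimitive θ k) :
    ∃ θ' k' : ℝ → ℝ, MemL2 k' ∧ IsPrimitive θ' k' ∧ θ' 0 = θ 0 ∧ θ' 1 = θ 1 ∧
      (∀ F : ℝ → ℝ, ∫ x in (0 : ℝ)..1, F (θ' x) = ∫ x in (0 : ℝ)..1, σ x * F (θ x)) ∧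
      ∫ x in (0 : ℝ)..1, k' x ^ 2 = ∫ x in (0 : ℝ)..1, k x ^ 2 / σ x := by
  have hsc := continuous_clampExt hσ
  have hsp : ∀ x, 0 < clampExt σ x := fun x => hpos _ (projIcc 0 1 zero_le_one x).2
  obtain ⟨S, hS⟩ : ∃ S : ℝ → ℝ, S = fun x => ∫ t in (0 : ℝ)..x, clampExt σ t := ⟨_, rfl⟩
  have hSd : ∀ x, HasDerivAt S (clampExt σ x) x := fun x => by
    rw [hS]
    exact intervalIntegral.integral_hasDerivAt_right (hsc.intervalIntegrable _ _)
      (hsc.stronglyMeasurableAtFilter _ _) hsc.continuousAt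
  have hSm : StrictMono S := strictMono_of_hasDerivAt_pos hSd hsp
  have hScont : Continuous S := continuous_iff_continuousAt.2 fun x => (hSd x).continuousAt
  have hS0 : S 0 = 0 := by rw [hS]; exact intervalIntegral.integral_same
  have hS1 : S 1 = 1 := by
    rw [hS]
    refine Eq.trans ?_ h1
    refine intervalIntegral.integral_congr fun t ht => ?_
    rw [uIcc_of_le zero_le_one] at ht
    exact clampExt_eq ht
  have himg : ∀ x, 0 ≤ x → S '' Ioo 0 x = Ioo 0 (S x) := by
    intro x hx
    refine Subset.antisymm ?_ ?_
    · rintro _ ⟨t, ht, rfl⟩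
      exact ⟨by rw [← hS0]; exact hSm ht.1, hSm ht.2⟩
    · have := intermediate_value_Ioo hx hScont.continuousOn
      rwa [hS0] at this
  -- Any left inverse of `S` will do: integrals and integrability in the new variable are pulled
  -- back along `S`, so no regularity of `X` is used.
  obtain ⟨X, hXS⟩ : ∃ X : ℝ → ℝ, ∀ x, X (S x) = x :=
    ⟨Function.invFun S, Function.leftInverse_invFun hSm.injective⟩
  have hcv : ∀ (g : ℝ → ℝ) (x : ℝ), 0 ≤ x →
      ∫ y in (0 : ℝ)..S x, g y = ∫ t in (0 : ℝ)..x, clampExt σ t * g (S t) := by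
    intro g x hx
    have hSx : 0 ≤ S x := by rw [← hS0]; exact hSm.monotone hx
    rw [intervalIntegral.integral_of_le hSx, intervalIntegral.integral_of_le hx,
      integral_Ioc_eq_integral_Ioo, integral_Ioc_eq_integral_Ioo, ← himg x hx,
      integral_image_eq_integral_abs_deriv_smul measurableSet_Ioo
        (fun t _ => (hSd t).hasDerivWithinAt) hSm.injective.injOn]
    simp only [abs_of_pos (hsp _), smul_eq_mul]
  have hci : ∀ g : ℝ → ℝ, IntervalIntegrable (fun t => clampExt σ t * g (S t)) volume 0 1 →
      IntervalIntegrable g volume 0 1 := by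
    intro g hg
    have := integrableOn_image_iff_integrableOn_abs_deriv_smul measurableSet_Ioo
        (fun t _ => (hSd t).hasDerivWithinAt) (hSm.injective.injOn (s := Ioo 0 1)) g
    rw [himg 1 zero_le_one, hS1] at this
    refine intervalIntegrable_unit_iff.2 (this.2 ?_)
    simp only [abs_of_pos (hsp _), smul_eq_mul]
    exact intervalIntegrable_unit_iff.1 hg
  have hk1 : ∀ t, clampExt σ t * (k (X (S t)) / clampExt σ (X (S t))) = k t := fun t => by
    rw [hXS, mul_div_cancel₀ _ (hsp t).ne']
  have hk2 : ∀ t, clampExt σ t * (k (X (S t)) / clampExt σ (X (S t))) ^ 2 =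
      k t ^ 2 / clampExt σ t := fun t => by
    have := (hsp t).ne'
    rw [hXS]; field_simp
  have hki : IntervalIntegrable (fun y => k (X y) / clampExt σ (X y)) volume 0 1 :=
    hci _ (by simpa only [hk1] using hθ.1)
  have hki2 : IntervalIntegrable (fun y => (k (X y) / clampExt σ (X y)) ^ 2) volume 0 1 :=
    hci _ (by
      simpa only [hk2] using hk.integrable_sq_div hsc.continuousOn fun x _ => hsp x)
  refine ⟨fun y => θ (X y), fun y => k (X y) / clampExt σ (X y), ?_, ⟨hki, ?_⟩, ?_, ?_, ?_, ?_⟩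
  · exact (memLp_two_iff_integrable_sq (intervalIntegrable_unit_iff.1 hki).aestronglyMeasurable).2
      (intervalIntegrable_unit_iff.1 hki2)
  · intro y hy
    obtain ⟨x, hx, rfl⟩ : y ∈ S '' Icc 0 1 := by
      have := intermediate_value_Icc zero_le_one hScont.continuousOn
      rw [hS0, hS1] at this
      exact this hy
    have hX0 : X 0 = 0 := by conv_lhs => rw [← hS0, hXS]
    simp only [hcv _ x hx.1, hk1]
    rw [hXS, hX0]
    exact hθ.2 x hx
  · show θ (X 0) = θ 0
    conv_lhs => rw [← hS0, hXS]
  · show θ (X 1) = θ 1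
    conv_lhs => rw [← hS1, hXS]
  · intro F
    have := hcv (fun y => F (θ (X y))) 1 zero_le_one
    rw [hS1] at this
    rw [this]
    refine intervalIntegral.integral_congr fun t ht => ?_
    rw [uIcc_of_le zero_le_one] at ht
    simp only [hXS, clampExt_eq ht]
  · have := hcv (fun y => (k (X y) / clampExt σ (X y)) ^ 2) 1 zero_le_one
    rw [hS1] at this
    rw [this]
    refine intervalIntegral.integral_congr fun t ht => ?_
    rw [uIcc_of_le zero_le_one] at ht
    simp only [hk2]
    rw [clampExt_eq ht]

/-- Arclength description of a curve in `A'_ℓ` by its tangent angle. -/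
theorem exists_angle_of_mem_balancedCurves {ℓ : ℝ} {γ : ℝ → Plane} (hγ : γ ∈ balancedCurves ℓ) :
    ∃ θ k : ℝ → ℝ, MemL2 k ∧ IsPrimitive θ k ∧ θ 1 = θ 0 ∧
      ∫ x in (0 : ℝ)..1, Real.cos (θ x) = ℓ ∧ ∫ x in (0 : ℝ)..1, Real.sin (θ x) = 0 ∧
      bending γ = ENNReal.ofReal (∫ x in (0 : ℝ)..1, k x ^ 2) := by
  obtain ⟨⟨⟨hH2, hne⟩, h0, h1, hL⟩, θ, ⟨hθ1, hθ⟩, hTC⟩ := hγ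
  obtain ⟨p, g, -, hp, hpg⟩ := hH2.exists_isPrimitive
  obtain ⟨k, hk, hθk⟩ := hθ1.exists_isPrimitive
  have hpc := hpg.continuousOn
  have hdx : ∀ x ∈ Icc (0 : ℝ) 1, dx γ x = p x := fun x hx => hp.dx_eq hpc hx
  have hnc : ContinuousOn (fun x => ‖dx γ x‖) (Icc 0 1) :=
    hpc.norm.congr fun x hx => by simp only [hdx x hx]
  have hnp : ∀ x ∈ Icc (0 : ℝ) 1, 0 < ‖dx γ x‖ := fun x hx => norm_pos_iff.2 (hne x hx)
  have hL1 : ∫ x in (0 : ℝ)..1, ‖dx γ x‖ = 1 := by rw [← integral_unit]; exact hL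
  obtain ⟨θ', k', hk', hθk', e0, e1, hF, hB⟩ := exists_arclength_reparam hnc hnp hL1 hk hθk
  have hpt : ∀ x ∈ Icc (0 : ℝ) 1, p x = ‖dx γ x‖ • unitVec (θ x) := by
    intro x hx
    rw [unitVec, ← hθ x hx, tangent, ds, smul_smul, mul_inv_cancel₀ (hnp x hx).ne', one_smul,
      hdx x hx]
  have hint : ∫ x in (0 : ℝ)..1, p x = !₂[ℓ, 0] := by
    have := hp.2 1 ⟨zero_le_one, le_rfl⟩
    rw [h0, h1] at this
    rw [this]
    ext i; fin_cases i <;> simp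
  have hcomp : ∀ i : Fin 2, ∫ x in (0 : ℝ)..1, ‖dx γ x‖ * unitVec (θ x) i = !₂[ℓ, 0] i := by
    intro i
    rw [← hint]
    refine Eq.trans ?_ ((EuclideanSpace.proj i : Plane →L[ℝ] ℝ).intervalIntegral_comp_comm hp.1)
    refine intervalIntegral.integral_congr fun x hx => ?_
    rw [uIcc_of_le zero_le_one] at hx
    show _ = (p x) i
    rw [hpt x hx]
    rfl
  refine ⟨θ', k', hk', hθk', ?_, ?_, ?_, ?_⟩
  · rw [e0, e1, ← sub_eq_zero, hθk.sub_eq ⟨le_rfl, zero_le_one⟩ ⟨zero_le_one, le_rfl⟩,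
      ← integral_unit]
    refine Eq.trans ?_ hTC
    refine integral_congr_ae ((ae_restrict_iff' measurableSet_Ioo).2 ?_)
    filter_upwards [hθk.ae_dx_eq] with x hx hm
    have := (hnp x (Ioo_subset_Icc_self hm)).ne'
    rw [ds, hx hm, smul_eq_mul]
    field_simp
  · rw [hF]; simpa [unitVec] using hcomp 0
  · rw [hF]; simpa [unitVec] using hcomp 1
  · rw [hB]; exact bending_eq hk hθk hnc hne fun x hx => hθ x hx

/-! ### Closed curves as competitors for `ϖ*` -/

/-- A closed curve with velocity `V(θ) (cos θ, sin θ)` bounds `ϖ*` by its scale invariant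
energy. -/
theorem varpiStar_le {θ k V : ℝ → ℝ} (hk : MemL2 k) (hθ : IsPrimitive θ k) (hV : ContDiff ℝ 1 V)
    (hpos : ∀ τ, 0 < V τ) (hc : ∫ x in (0 : ℝ)..1, V (θ x) * Real.cos (θ x) = 0)
    (hs : ∫ x in (0 : ℝ)..1, V (θ x) * Real.sin (θ x) = 0) :
    varpiStar ≤ ENNReal.ofReal
      ((∫ x in (0 : ℝ)..1, V (θ x)) * ∫ x in (0 : ℝ)..1, k x ^ 2 / V (θ x)) := by
  set Λ : ℝ := ∫ x in (0 : ℝ)..1, V (θ x) with hΛ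
  have hθc := hθ.continuousOn
  have hVc : ContinuousOn (fun x => V (θ x)) (Icc 0 1) := hV.continuous.comp_continuousOn hθc
  have hΛp : 0 < Λ := by
    refine intervalIntegral.intervalIntegral_pos_of_pos_on ?_ (fun x _ => hpos _) zero_lt_one
    exact ContinuousOn.intervalIntegrable (by rwa [uIcc_of_le zero_le_one])
  -- The factor `Λ⁻¹` rescales the curve to length one, which multiplies its energy by `Λ`.
  set P : ℝ → Plane := fun τ => Λ⁻¹ • V τ • unitVec τ with hP
  have hPd : ContDiff ℝ 1 P := contDiff_const.fun_smul (hV.fun_smul contDiff_unitVec)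
  have hPn : ∀ τ, ‖P τ‖ = Λ⁻¹ * V τ := fun τ => by
    rw [hP]
    simp only [norm_smul, norm_unitVec, mul_one, Real.norm_eq_abs, abs_of_pos (hpos τ),
      abs_of_pos (inv_pos.2 hΛp)]
  have hPne : ∀ τ, P τ ≠ 0 := fun τ => by
    rw [← norm_pos_iff, hPn]; exact mul_pos (inv_pos.2 hΛp) (hpos τ)
  have hq := hθ.contDiff_comp hPd
  have hqc := hq.continuousOn
  set c : ℝ → Plane := fun x => ∫ t in (0 : ℝ)..x, P (θ t) with hcdef
  have hqi : IntervalIntegrable (fun x => P (θ x)) volume 0 1 :=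
    ContinuousOn.intervalIntegrable (by rwa [uIcc_of_le zero_le_one])
  have hcp : IsPrimitive c (fun x => P (θ x)) := ⟨hqi, fun x _ => by simp [hcdef]⟩
  have hdx : ∀ x ∈ Icc (0 : ℝ) 1, dx c x = P (θ x) := fun x hx => hcp.dx_eq hqc hx
  have hdn : ∀ x ∈ Icc (0 : ℝ) 1, ‖dx c x‖ = Λ⁻¹ * V (θ x) := fun x hx => by
    rw [hdx x hx, hPn]
  have hne : ∀ x ∈ Icc (0 : ℝ) 1, dx c x ≠ 0 := fun x hx => by rw [hdx x hx]; exact hPne _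
  have hL2 : MemL2 (fun x => k x • deriv P (θ x)) := by
    have hdc : ContinuousOn (fun x => deriv P (θ x)) (Icc 0 1) :=
      (hPd.continuous_deriv (by norm_num)).comp_continuousOn hθc
    obtain ⟨C, hC⟩ := isCompact_Icc.exists_bound_of_continuousOn hdc
    refine MemLp.of_le_mul hk (intervalIntegrable_unit_iff.1 hq.1).aestronglyMeasurable (c := C) ?_
    filter_upwards [ae_restrict_mem measurableSet_Ioo] with x hx
    rw [norm_smul, mul_comm]
    exact mul_le_mul_of_nonneg_right (hC x (Ioo_subset_Icc_self hx)) (norm_nonneg _)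
  have hint0 : ∀ i : Fin 2, (∫ x in (0 : ℝ)..1, P (θ x)) i = 0 := by
    intro i
    refine ((EuclideanSpace.proj i : Plane →L[ℝ] ℝ).intervalIntegral_comp_comm hqi).symm.trans ?_
    show ∫ x in (0 : ℝ)..1, Λ⁻¹ * (V (θ x) * unitVec (θ x) i) = 0
    rw [intervalIntegral.integral_const_mul]
    fin_cases i
    · simp only [unitVec]
      exact mul_eq_zero_of_right _ hc
    · simp only [unitVec]
      exact mul_eq_zero_of_right _ hs
  have hmem : c ∈ curves 0 := by
    refine ⟨⟨⟨hcp.continuousOn, hcp.memL2, _, _, hq.memL2, hL2, hcp.hasWeakDeriv, hq.hasWeakDeriv⟩,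
      hne⟩, ?_, ?_, ?_⟩
    · ext i; fin_cases i <;> simp [hcdef]
    · ext i
      show (∫ x in (0 : ℝ)..1, P (θ x)) i = _
      rw [hint0 i]; fin_cases i <;> simp
    · rw [length, integral_unit, intervalIntegral.integral_congr (g := fun x => Λ⁻¹ * V (θ x)),
        intervalIntegral.integral_const_mul, ← hΛ, inv_mul_cancel₀ hΛp.ne']
      intro x hx
      rw [uIcc_of_le zero_le_one] at hx
      exact hdn x hx
  have ht : ∀ x ∈ Icc (0 : ℝ) 1, tangent c x = unitVec (θ x) := by
    intro x hx
    rw [tangent, ds, hdn x hx, hdx x hx, hP]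
    simp only [smul_smul]
    rw [inv_mul_cancel₀ (mul_pos (inv_pos.2 hΛp) (hpos _)).ne', one_smul]
  refine (iInf₂_le c hmem).trans (le_of_eq ?_)
  rw [bending_eq hk hθ ((continuousOn_const.mul hVc).congr hdn) hne ht,
    ← intervalIntegral.integral_const_mul]
  congr 1
  refine intervalIntegral.integral_congr fun x hx => ?_
  rw [uIcc_of_le zero_le_one] at hx
  have h1 := (hpos (θ x)).ne'
  have h2 := hΛp.ne'
  simp only [hdn x hx]
  field_simp

/-! ### Self-intersection of closed curves of rotation number zero -/

/-- Uniqueness of lifts through the covering `exp`: `g` and its translates are lifts of the same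
constant map. -/
theorem eq_of_continuous_of_exp_eq {g : ℝ → ℂ} (hg : Continuous g) {c : ℂ}
    (h : ∀ x, Complex.exp (g x) = c) (x y : ℝ) : g x = g y :=
  Complex.isCoveringMap_exp.isSeparatedMap.const_of_comp
    Complex.isCoveringMap_exp.isLocalHomeomorph.isLocallyInjective hg
    (fun a b => Subtype.ext ((h a).trans (h b).symm)) x y

theorem exists_continuous_log {X : Type*} [TopologicalSpace X] [SimplyConnectedSpace X]
    [LocallyPathConnectedSpace X] {f : X → ℂ} (hf : Continuous f) (h0 : ∀ x, f x ≠ 0) :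
    ∃ L : X → ℂ, Continuous L ∧ ∀ x, Complex.exp (L x) = f x := by
  obtain ⟨x₀⟩ : Nonempty X := inferInstance
  obtain ⟨L, ⟨-, hL⟩, -⟩ := Complex.isCoveringMapOn_exp.existsUnique_continuousMap_lifts
    ⟨f, hf⟩ (Complex.exp_log (h0 x₀)) h0
  exact ⟨L, L.continuous, fun x => congrFun hL x⟩

/-- The difference of the mean values of `p` over `[s, s + h]` and over `[s + h, s + 1]`; it is a
positive multiple of the chord `∫_s^{s+h} p` when `p` has mean zero and period `1`. -/
noncomputable def chordField (p : ℝ → ℂ) (s h : ℝ) : ℂ :=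
  ∫ u in (0 : ℝ)..1, (p (s + h * u) - p (s + h + (1 - h) * u))

theorem continuous_chordField {p : ℝ → ℂ} (hp : Continuous p) :
    Continuous fun z : ℝ × ℝ => chordField p z.1 z.2 :=
  intervalIntegral.continuous_parametric_intervalIntegral_of_continuous'
    (f := fun (z : ℝ × ℝ) (u : ℝ) => p (z.1 + z.2 * u) - p (z.1 + z.2 + (1 - z.2) * u))
    (by simp only [Function.uncurry_def]; fun_prop) 0 1

/-- The complementary arc has the same endpoints in the opposite order, so its chord is reversed. -/
theorem chordField_symm {p : ℝ → ℂ} (hper : Function.Periodic p 1) (s h : ℝ) :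
    chordField p (s + h) (1 - h) = -chordField p s h := by
  rw [chordField, chordField, ← intervalIntegral.integral_neg]
  refine intervalIntegral.integral_congr fun u _ => ?_
  have : p (s + h + (1 - h) + (1 - (1 - h)) * u) = p (s + h * u) := by
    rw [← hper (s + h * u)]; congr 1; ring
  simp only [this, neg_sub]

theorem integral_period {p : ℝ → ℂ} (hper : Function.Periodic p 1)
    (h0 : ∫ t in (0 : ℝ)..1, p t = 0) (s : ℝ) : ∫ t in s..s + 1, p t = 0 := by
  rw [hper.intervalIntegral_add_eq s 0, zero_add, h0]

/-- For `h = 0` the first mean degenerates to the value at `s` and the second is the mean over a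
period. Normalizing by means rather than taking the bare chord thus gives a continuous extension by
the tangent. -/
theorem chordField_zero {p : ℝ → ℂ} (hp : Continuous p) (hper : Function.Periodic p 1)
    (h0 : ∫ t in (0 : ℝ)..1, p t = 0) (s : ℝ) : chordField p s 0 = p s := by
  simp only [chordField, zero_mul, add_zero, sub_zero, one_mul]
  rw [intervalIntegral.integral_sub (continuous_const.intervalIntegrable _ _)
    (Continuous.intervalIntegrable (by fun_prop) _ _), intervalIntegral.integral_comp_add_left,
    add_zero, integral_period hper h0]
  simp

theorem chordField_one {p : ℝ → ℂ} (hp : Continuous p) (hper : Function.Periodic p 1)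
    (h0 : ∫ t in (0 : ℝ)..1, p t = 0) (s : ℝ) : chordField p s 1 = -p s := by
  have := chordField_symm hper s 0
  rw [add_zero, sub_zero, chordField_zero hp hper h0] at this
  exact this

theorem integral_eq_zero_of_chordField_eq_zero {p : ℝ → ℂ} (hp : Continuous p)
    (hper : Function.Periodic p 1) (h0 : ∫ t in (0 : ℝ)..1, p t = 0) {s h : ℝ} (hh : 0 < h)
    (hh1 : h < 1) (hz : chordField p s h = 0) : ∫ t in s..s + h, p t = 0 := by
  have h1 : (1 - h) ≠ 0 := by linarith
  have hsum : (∫ t in s..s + h, p t) + ∫ t in s + h..s + 1, p t = 0 := by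
    rw [intervalIntegral.integral_add_adjacent_intervals (hp.intervalIntegrable _ _)
      (hp.intervalIntegrable _ _), integral_period hper h0]
  rw [chordField, intervalIntegral.integral_sub (Continuous.intervalIntegrable (by fun_prop) _ _)
    (Continuous.intervalIntegrable (by fun_prop) _ _),
    intervalIntegral.integral_comp_add_mul _ hh.ne', intervalIntegral.integral_comp_add_mul _ h1] at hz
  have e : s + h + (1 - h) * 1 = s + 1 := by ring
  rw [mul_zero, mul_one, add_zero, mul_zero, add_zero, e, eq_neg_of_add_eq_zero_right hsum, smul_neg,
    sub_neg_eq_add, ← add_smul] at hz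
  refine (smul_eq_zero.1 hz).resolve_left ?_
  have : 0 < 1 - h := by linarith
  positivity

/-- A closed `C¹` curve with rotation number zero has a self-intersection. -/
theorem exists_integral_eq_zero {q : ℝ → ℂ} (hq : Continuous q) (hper : Function.Periodic q 1)
    (h0 : ∫ t in (0 : ℝ)..1, Complex.exp (q t) = 0) :
    ∃ s h : ℝ, 0 < h ∧ h < 1 ∧ ∫ t in s..s + h, Complex.exp (q t) = 0 := by
  by_contra! hcon
  set p : ℝ → ℂ := fun t => Complex.exp (q t) with hpdef
  have hp : Continuous p := Complex.continuous_exp.comp hq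
  have hpp : Function.Periodic p 1 := fun x => by simp only [hpdef, hper x]
  -- Clamping `h` to `[0,1]` defines the nonvanishing field on the whole plane, where lifting
  -- applies directly.
  set cl : ℝ → ℝ := fun h => projIcc 0 1 zero_le_one h with hcl
  have hclc : Continuous cl := continuous_subtype_val.comp continuous_projIcc
  have hcl01 : ∀ h, cl h ∈ Icc (0 : ℝ) 1 := fun h => (projIcc 0 1 zero_le_one h).2
  have hcle : ∀ h ∈ Icc (0 : ℝ) 1, cl h = h := fun h hh => by
    simp only [hcl, projIcc_of_mem zero_le_one hh]
  have hne : ∀ s, ∀ h ∈ Icc (0 : ℝ) 1, chordField p s h ≠ 0 := by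
    intro s h hh hz
    rcases eq_or_lt_of_le hh.1 with rfl | h1
    · rw [chordField_zero hp hpp h0] at hz
      exact Complex.exp_ne_zero _ hz
    rcases eq_or_lt_of_le hh.2 with rfl | h2
    · rw [chordField_one hp hpp h0, neg_eq_zero] at hz
      exact Complex.exp_ne_zero _ hz
    exact hcon s h h1 h2 (integral_eq_zero_of_chordField_eq_zero hp hpp h0 h1 h2 hz)
  obtain ⟨L, hL, hLe⟩ := exists_continuous_log
    (f := fun z : ℝ × ℝ => chordField p z.1 (cl z.2))
    ((continuous_chordField hp).comp (continuous_fst.prodMk (hclc.comp continuous_snd)))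
    (fun z => hne _ _ (hcl01 _))
  -- Reversing a chord changes the logarithm by an odd multiple of `πi`, which by continuity does
  -- not depend on `h`. At `h = 0` it is `L (0, 1) - L (0, 0)`, at `h = 1` it is `L (1, 0) - L (0,
  -- 1)`.
  have hd : ∀ h, Complex.exp (L (cl h, 1 - cl h) - L (0, cl h)) = -1 := by
    intro h
    have h1 := hcl01 h
    have e := chordField_symm hpp 0 (cl h)
    rw [zero_add] at e
    rw [Complex.exp_sub, hLe, hLe]
    simp only [hcle _ h1, hcle (1 - cl h) ⟨by linarith [h1.2], by linarith [h1.1]⟩, e]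
    rw [neg_div, div_self (hne _ _ h1)]
  have hdc := eq_of_continuous_of_exp_eq
    (g := fun h => L (cl h, 1 - cl h) - L (0, cl h)) (by fun_prop) hd 0 1
  -- On the row `h = 0` the field is `exp ∘ q`, so `L` differs from `q` by a constant and
  -- periodicity of `q` gives `L (1, 0) = L (0, 0)`. This is where rotation number zero enters.
  have hrow : ∀ s, Complex.exp (L (s, 0) - q s) = 1 := by
    intro s
    rw [Complex.exp_sub, hLe]
    simp only [hcle 0 ⟨le_rfl, zero_le_one⟩, chordField_zero hp hpp h0]
    exact div_self (Complex.exp_ne_zero _)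
  have hrc := eq_of_continuous_of_exp_eq (g := fun s => L (s, 0) - q s) (by fun_prop) hrow 0 1
  have hq1 : q 1 = q 0 := by simpa using hper 0
  have c0 := hcle 0 ⟨le_rfl, zero_le_one⟩
  have c1 := hcle 1 ⟨zero_le_one, le_rfl⟩
  have e0 := hd 0
  simp only [c0, c1, sub_zero, sub_self, hq1] at hdc hrc e0
  -- The two equal increments add up to zero, so each is zero, although its exponential is `-1`.
  have hz : L (0, 1) - L (0, 0) = 0 := by
    linear_combination (1 / 2 : ℂ) * hdc - (1 / 2 : ℂ) * hrc
  rw [hz, Complex.exp_zero] at e0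
  norm_num at e0

/-! ### Cutting a closed curve into two loops -/

/-- One of the two arcs cut off at a crossing may run past the parameter `1`. Zero total curvature,
`θ 1 = θ 0`, is what makes the extended angle itself periodic, and not merely periodic modulo `2π`.
-/
theorem exists_periodic_extension {θ k : ℝ → ℝ} (hk : MemL2 k) (hθ : IsPrimitive θ k)
    (h01 : θ 1 = θ 0) :
    ∃ Θ K : ℝ → ℝ, Function.Periodic Θ 1 ∧ Function.Periodic K 1 ∧ Continuous Θ ∧
      (∀ a b, IntervalIntegrable K volume a b) ∧
      (∀ a b, IntervalIntegrable (fun x => K x ^ 2) volume a b) ∧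
      (∀ a b, Θ b = Θ a + ∫ t in a..b, K t) ∧
      (∀ x ∈ Ioo (0 : ℝ) 1, Θ x = θ x) ∧ (∀ x ∈ Ioo (0 : ℝ) 1, K x = k x) := by
  have hfr : ∀ x ∈ Ioo (0 : ℝ) 1, k (Int.fract x) = k x := fun x hx => by
    rw [Int.fract_eq_self.2 ⟨hx.1.le, hx.2⟩]
  have hfr' : ∀ᵐ x ∂volume.restrict (Ioo (0 : ℝ) 1), k x = k (Int.fract x) := by
    filter_upwards [ae_restrict_mem measurableSet_Ioo] with x hx using (hfr x hx).symm
  have hKp : Function.Periodic (fun x : ℝ => k (Int.fract x)) 1 := fun x => by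
    simp only [Int.fract_add_one]
  have hK2p : Function.Periodic (fun x : ℝ => k (Int.fract x) ^ 2) 1 := fun x => by
    simp only [Int.fract_add_one]
  have hKi : ∀ a b, IntervalIntegrable (fun x : ℝ => k (Int.fract x)) volume a b :=
    hKp.intervalIntegrable₀ one_ne_zero
      (intervalIntegrable_unit_iff.2 ((intervalIntegrable_unit_iff.1 hθ.1).congr hfr'))
  have hk2 : Integrable (fun x => k x ^ 2) (volume.restrict (Ioo (0 : ℝ) 1)) :=
    (memLp_two_iff_integrable_sq hk.aestronglyMeasurable).1 hk
  have hK2i : ∀ a b, IntervalIntegrable (fun x : ℝ => k (Int.fract x) ^ 2) volume a b :=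
    hK2p.intervalIntegrable₀ one_ne_zero (intervalIntegrable_unit_iff.2 (hk2.congr (by
      filter_upwards [hfr'] with x hx
      rw [hx])))
  have hint : ∀ x ∈ Icc (0 : ℝ) 1, ∫ t in (0 : ℝ)..x, k (Int.fract t) = ∫ t in (0 : ℝ)..x, k t := by
    intro x hx
    rw [intervalIntegral.integral_of_le hx.1, intervalIntegral.integral_of_le hx.1,
      integral_Ioc_eq_integral_Ioo, integral_Ioc_eq_integral_Ioo]
    exact setIntegral_congr_fun measurableSet_Ioo fun t ht => hfr t ⟨ht.1, ht.2.trans_le hx.2⟩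
  have hK0 : ∫ t in (0 : ℝ)..1, k (Int.fract t) = 0 := by
    rw [hint 1 ⟨zero_le_one, le_rfl⟩, ← hθ.sub_eq ⟨le_rfl, zero_le_one⟩ ⟨zero_le_one, le_rfl⟩, h01,
      sub_self]
  have hΘ : ∀ a b, (θ 0 + ∫ t in (0 : ℝ)..b, k (Int.fract t)) =
      (θ 0 + ∫ t in (0 : ℝ)..a, k (Int.fract t)) + ∫ t in a..b, k (Int.fract t) := fun a b => by
    rw [add_assoc, intervalIntegral.integral_add_adjacent_intervals (hKi _ _) (hKi _ _)]
  refine ⟨fun x => θ 0 + ∫ t in (0 : ℝ)..x, k (Int.fract t), fun x => k (Int.fract x), ?_, hKp,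
    continuous_const.add (intervalIntegral.continuous_primitive hKi 0), hKi, hK2i, hΘ, ?_, hfr⟩
  · intro x
    simp only [hΘ x (x + 1)]
    rw [hKp.intervalIntegral_add_eq x 0, zero_add, hK0, add_zero]
  · intro x hx
    simp only [hint x (Ioo_subset_Icc_self hx)]
    exact (hθ.2 x (Ioo_subset_Icc_self hx)).symm

/-- `varpiStar_le` for a closed arc over a parameter interval `[s, s + h]`. -/
theorem varpiStar_le_arc {Θ K V : ℝ → ℝ} (hΘ : ∀ a b, Θ b = Θ a + ∫ t in a..b, K t)
    (hKi : ∀ a b, IntervalIntegrable K volume a b)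
    (hK2i : ∀ a b, IntervalIntegrable (fun x => K x ^ 2) volume a b)
    (hV : ContDiff ℝ 1 V) (hpos : ∀ τ, 0 < V τ) {s h : ℝ} (hh : 0 < h)
    (hc : ∫ x in s..s + h, V (Θ x) * Real.cos (Θ x) = 0)
    (hs : ∫ x in s..s + h, V (Θ x) * Real.sin (Θ x) = 0) :
    varpiStar ≤ ENNReal.ofReal
      ((∫ x in s..s + h, V (Θ x)) * ∫ x in s..s + h, K x ^ 2 / V (Θ x)) := by
  have hresc : ∀ f : ℝ → ℝ, IntervalIntegrable f volume s (s + h) →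
      IntervalIntegrable (fun x => f (s + h * x)) volume 0 1 := by
    intro f hf
    have := (hf.comp_add_left s).comp_mul_left (c := h)
    simpa [div_self hh.ne'] using this
  have hcv : ∀ f : ℝ → ℝ, ∫ x in (0 : ℝ)..1, f (s + h * x) = h⁻¹ * ∫ x in s..s + h, f x := by
    intro f
    rw [intervalIntegral.integral_comp_add_mul _ hh.ne', mul_zero, mul_one, add_zero, smul_eq_mul]
  have hi : IntervalIntegrable (fun x => h * K (s + h * x)) volume 0 1 :=
    (hresc K (hKi _ _)).const_mul h
  have hprim : IsPrimitive (fun x => Θ (s + h * x)) (fun x => h * K (s + h * x)) := by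
    refine ⟨hi, fun x _ => ?_⟩
    rw [intervalIntegral.integral_const_mul, intervalIntegral.mul_integral_comp_add_mul]
    exact hΘ _ _
  have hL2 : MemL2 (fun x => h * K (s + h * x)) := by
    refine (memLp_two_iff_integrable_sq
      (intervalIntegrable_unit_iff.1 hi).aestronglyMeasurable).2 ?_
    simp only [mul_pow]
    exact intervalIntegrable_unit_iff.1 ((hresc _ (hK2i _ _)).const_mul (h ^ 2))
  have key := varpiStar_le hL2 hprim hV hpos
    (by rw [hcv (fun y => V (Θ y) * Real.cos (Θ y)), hc, mul_zero])
    (by rw [hcv (fun y => V (Θ y) * Real.sin (Θ y)), hs, mul_zero])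
  refine key.trans (le_of_eq ?_)
  congr 1
  rw [hcv (fun y => V (Θ y))]
  have : ∫ x in (0 : ℝ)..1, (h * K (s + h * x)) ^ 2 / V (Θ (s + h * x)) =
      h * ∫ x in s..s + h, K x ^ 2 / V (Θ x) := by
    have h2 := hcv (fun y => K y ^ 2 / V (Θ y))
    simp only [mul_pow, mul_div_assoc]
    rw [intervalIntegral.integral_const_mul, h2]
    field_simp
  rw [this]
  field_simp

/-- Writes the velocity as the exponential of `log V + iΘ`, the form required by
`exists_integral_eq_zero`; this exponent is periodic whenever `Θ` is. -/
theorem integral_exp_re_im {Θ V : ℝ → ℝ} (hΘ : Continuous Θ) (hV : Continuous V)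
    (hpos : ∀ τ, 0 < V τ) (a b : ℝ) :
    (∫ t in a..b, Complex.exp (Real.log (V (Θ t)) + Θ t * Complex.I)).re =
        ∫ t in a..b, V (Θ t) * Real.cos (Θ t) ∧
    (∫ t in a..b, Complex.exp (Real.log (V (Θ t)) + Θ t * Complex.I)).im =
        ∫ t in a..b, V (Θ t) * Real.sin (Θ t) := by
  have hlog : Continuous fun t => Real.log (V (Θ t)) :=
    (hV.comp hΘ).log fun t => (hpos _).ne'
  have hc : Continuous fun t => Complex.exp (Real.log (V (Θ t)) + Θ t * Complex.I) := by fun_prop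
  have hi := hc.intervalIntegrable (μ := volume) a b
  refine ⟨(Complex.reCLM.intervalIntegral_comp_comm hi).symm.trans ?_,
    (Complex.imCLM.intervalIntegral_comp_comm hi).symm.trans ?_⟩
  · refine intervalIntegral.integral_congr fun t _ => ?_
    simp [Complex.exp_re, Real.exp_log (hpos _)]
  · refine intervalIntegral.integral_congr fun t _ => ?_
    simp [Complex.exp_im, Real.exp_log (hpos _)]

/-- The diagonal products contribute `2w`, and the cross terms satisfy `L₁E₂ + L₂E₁ ≥ 2 √(L₁E₁ ·
L₂E₂) ≥ 2w`. -/
theorem four_mul_le_add_mul_add {w L₁ L₂ E₁ E₂ : ℝ} (hw : 0 ≤ w) (hL₁ : 0 ≤ L₁) (hL₂ : 0 ≤ L₂)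
    (hE₁ : 0 ≤ E₁) (hE₂ : 0 ≤ E₂) (h₁ : w ≤ L₁ * E₁) (h₂ : w ≤ L₂ * E₂) :
    4 * w ≤ (L₁ + L₂) * (E₁ + E₂) := by
  have h3 : w ^ 2 ≤ (L₁ * E₂) * (L₂ * E₁) := by
    have := mul_le_mul h₁ h₂ hw (by positivity)
    nlinarith
  have h4 : (2 * w) ^ 2 ≤ (L₁ * E₂ + L₂ * E₁) ^ 2 := by
    nlinarith [sq_nonneg (L₁ * E₂ - L₂ * E₁)]
  have h5 : 2 * w ≤ L₁ * E₂ + L₂ * E₁ := (sq_le_sq₀ (by positivity) (by positivity)).1 h4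
  nlinarith

/-- A closed `C¹` curve with zero total curvature has at least the energy of two drops. -/
theorem four_mul_varpiStar_le {θ k V : ℝ → ℝ} (hk : MemL2 k) (hθ : IsPrimitive θ k)
    (h01 : θ 1 = θ 0) (hV : ContDiff ℝ 1 V) (hpos : ∀ τ, 0 < V τ)
    (hc : ∫ x in (0 : ℝ)..1, V (θ x) * Real.cos (θ x) = 0)
    (hs : ∫ x in (0 : ℝ)..1, V (θ x) * Real.sin (θ x) = 0) :
    4 * varpiStar ≤ ENNReal.ofReal
      ((∫ x in (0 : ℝ)..1, V (θ x)) * ∫ x in (0 : ℝ)..1, k x ^ 2 / V (θ x)) := by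
  obtain ⟨Θ, K, hΘp, hKp, hΘc, hKi, hK2i, hΘ, hΘe, hKe⟩ := exists_periodic_extension hk hθ h01
  have htr : ∀ F G : ℝ → ℝ, (∀ x ∈ Ioo (0 : ℝ) 1, F x = G x) →
      ∫ x in (0 : ℝ)..1, F x = ∫ x in (0 : ℝ)..1, G x := fun F G h => by
    rw [← integral_unit, ← integral_unit]
    exact setIntegral_congr_fun measurableSet_Ioo h
  have hVc := hV.continuous
  have hI := integral_exp_re_im hΘc hVc hpos
  have hlog : Continuous fun t => Real.log (V (Θ t)) := (hVc.comp hΘc).log fun t => (hpos _).ne'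
  have c1 : ∫ x in (0 : ℝ)..1, V (Θ x) * Real.cos (Θ x) = 0 :=
    (htr _ _ fun x hx => by rw [hΘe x hx]).trans hc
  have c2 : ∫ x in (0 : ℝ)..1, V (Θ x) * Real.sin (Θ x) = 0 :=
    (htr _ _ fun x hx => by rw [hΘe x hx]).trans hs
  have h0 : ∫ t in (0 : ℝ)..1, Complex.exp (Real.log (V (Θ t)) + Θ t * Complex.I) = 0 :=
    Complex.ext ((hI 0 1).1.trans c1) ((hI 0 1).2.trans c2)
  obtain ⟨s, h, hh, hh1, hz⟩ := exists_integral_eq_zero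
    (q := fun t => Real.log (V (Θ t)) + Θ t * Complex.I) (by fun_prop)
    (fun x => by simp only [hΘp x]) h0
  have hzc : ∫ x in s..s + h, V (Θ x) * Real.cos (Θ x) = 0 := by
    rw [← (hI _ _).1, hz, Complex.zero_re]
  have hzs : ∫ x in s..s + h, V (Θ x) * Real.sin (Θ x) = 0 := by
    rw [← (hI _ _).2, hz, Complex.zero_im]
  have hsum : ∀ F : ℝ → ℝ, Function.Periodic F 1 → (∀ a b, IntervalIntegrable F volume a b) →
      (∫ x in s..s + h, F x) + ∫ x in s + h..s + h + (1 - h), F x = ∫ x in (0 : ℝ)..1, F x := by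
    intro F hF hFi
    rw [intervalIntegral.integral_add_adjacent_intervals (hFi _ _) (hFi _ _),
      show s + h + (1 - h) = s + 1 by ring, hF.intervalIntegral_add_eq s 0, zero_add]
  have hVΘc : Continuous fun x => V (Θ x) := hVc.comp hΘc
  have hci : ∀ f : ℝ → ℝ, Continuous f → ∀ a b, IntervalIntegrable f volume a b :=
    fun f hf a b => hf.intervalIntegrable a b
  have hEi : ∀ a b, IntervalIntegrable (fun x => K x ^ 2 / V (Θ x)) volume a b := by
    intro a b
    simp_rw [div_eq_mul_inv]
    exact (hK2i a b).mul_continuousOn (hVΘc.inv₀ fun x => (hpos _).ne').continuousOn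
  have k1 := varpiStar_le_arc hΘ hKi hK2i hV hpos hh hzc hzs
  have k2 := varpiStar_le_arc hΘ hKi hK2i hV hpos (s := s + h) (h := 1 - h) (by linarith)
    (by
      have := hsum (fun x => V (Θ x) * Real.cos (Θ x)) (fun x => by simp only [hΘp x])
        (hci _ (by fun_prop))
      rwa [hzc, zero_add, c1] at this)
    (by
      have := hsum (fun x => V (Θ x) * Real.sin (Θ x)) (fun x => by simp only [hΘp x])
        (hci _ (by fun_prop))
      rwa [hzs, zero_add, c2] at this)
  have eL := hsum (fun x => V (Θ x)) (fun x => by simp only [hΘp x]) (hci _ hVΘc)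
  have eE := hsum (fun x => K x ^ 2 / V (Θ x)) (fun x => by simp only [hΘp x, hKp x]) hEi
  have tL : ∫ x in (0 : ℝ)..1, V (Θ x) = ∫ x in (0 : ℝ)..1, V (θ x) :=
    htr _ _ fun x hx => by rw [hΘe x hx]
  have tE : ∫ x in (0 : ℝ)..1, K x ^ 2 / V (Θ x) = ∫ x in (0 : ℝ)..1, k x ^ 2 / V (θ x) :=
    htr _ _ fun x hx => by rw [hΘe x hx, hKe x hx]
  -- The first loop is itself a competitor of finite energy, so the rest can be done with real
  -- numbers.
  have hfin : varpiStar ≠ ⊤ := ne_top_of_le_ne_top ENNReal.ofReal_ne_top k1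
  have nL : ∀ a b : ℝ, a ≤ b → 0 ≤ ∫ x in a..b, V (Θ x) := fun a b hab =>
    intervalIntegral.integral_nonneg hab fun x _ => (hpos _).le
  have nE : ∀ a b : ℝ, a ≤ b → 0 ≤ ∫ x in a..b, K x ^ 2 / V (Θ x) := fun a b hab =>
    intervalIntegral.integral_nonneg hab fun x _ => div_nonneg (sq_nonneg _) (hpos _).le
  have l1 : s ≤ s + h := by linarith
  have l2 : s + h ≤ s + h + (1 - h) := by linarith
  rw [← ENNReal.ofReal_toReal hfin,
    ENNReal.ofReal_le_ofReal_iff (mul_nonneg (nL _ _ l1) (nE _ _ l1))] at k1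
  rw [← ENNReal.ofReal_toReal hfin,
    ENNReal.ofReal_le_ofReal_iff (mul_nonneg (nL _ _ l2) (nE _ _ l2))] at k2
  have := four_mul_le_add_mul_add ENNReal.toReal_nonneg (nL _ _ l1) (nL _ _ l2) (nE _ _ l1)
    (nE _ _ l2) k1 k2
  rw [eL, eE, tL, tE] at this
  rw [← ENNReal.ofReal_toReal hfin, ← ENNReal.ofReal_ofNat 4, ← ENNReal.ofReal_mul (by norm_num)]
  exact ENNReal.ofReal_le_ofReal this

/-! ### Closing up an almost closed curve -/

theorem sq_integral_le {k : ℝ → ℝ} {a b : ℝ} (hab : a < b) (hk : IntervalIntegrable k volume a b)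
    (hk2 : IntervalIntegrable (fun x => k x ^ 2) volume a b) :
    (∫ x in a..b, k x) ^ 2 ≤ (b - a) * ∫ x in a..b, k x ^ 2 := by
  set I := ∫ x in a..b, k x with hI
  set m := I / (b - a) with hm
  have h0 : 0 ≤ ∫ x in a..b, (k x - m) ^ 2 :=
    intervalIntegral.integral_nonneg hab.le fun x _ => sq_nonneg _
  have e : ∀ x, (k x - m) ^ 2 = k x ^ 2 - 2 * m * k x + m ^ 2 := fun x => by ring
  simp only [e] at h0
  rw [intervalIntegral.integral_add (hk2.sub (hk.const_mul _)) intervalIntegrable_const,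
    intervalIntegral.integral_sub hk2 (hk.const_mul _), intervalIntegral.integral_const_mul,
    intervalIntegral.integral_const, smul_eq_mul, ← hI] at h0
  have hpos : 0 < b - a := sub_pos.2 hab
  have hmI : m * (b - a) = I := div_mul_cancel₀ _ hpos.ne'
  have h1 := mul_nonneg hpos.le h0
  have h2 : (b - a) * ((∫ x in a..b, k x ^ 2) - 2 * m * I + (b - a) * m ^ 2) =
      (b - a) * (∫ x in a..b, k x ^ 2) - I ^ 2 := by
    rw [← hmI]; ring
  linarith

/-- Bounded energy makes the angle Hölder continuous of exponent `1/2`, by the Cauchy-Schwarz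
inequality. -/
theorem IsPrimitive.sq_sub_le {θ k : ℝ → ℝ} (hk : MemL2 k) (hθ : IsPrimitive θ k) {c : ℝ}
    (hc : ∫ x in (0 : ℝ)..1, k x ^ 2 ≤ c) {x y : ℝ} (hx : x ∈ Icc (0 : ℝ) 1)
    (hy : y ∈ Icc (0 : ℝ) 1) : (θ y - θ x) ^ 2 ≤ c * |y - x| := by
  wlog hxy : x ≤ y generalizing x y
  · rw [← neg_sub (θ x), neg_sq, abs_sub_comm]
    exact this hy hx (le_of_not_ge hxy)
  rcases hxy.eq_or_lt with rfl | hlt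
  · simp
  have hk2 : IntervalIntegrable (fun x => k x ^ 2) volume 0 1 :=
    intervalIntegrable_unit_iff.2 ((memLp_two_iff_integrable_sq hk.aestronglyMeasurable).1 hk)
  have hsub : uIcc x y ⊆ uIcc (0 : ℝ) 1 := by
    rw [uIcc_of_le hxy, uIcc_of_le zero_le_one]; exact Icc_subset_Icc hx.1 hy.2
  rw [hθ.sub_eq hx hy, abs_of_pos (sub_pos.2 hlt), mul_comm]
  refine (sq_integral_le hlt (hθ.1.mono_set hsub) (hk2.mono_set hsub)).trans ?_
  refine mul_le_mul_of_nonneg_left (le_trans ?_ hc) (sub_pos.2 hlt).le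
  exact intervalIntegral.integral_mono_interval hx.1 hxy hy.2
    (Eventually.of_forall fun x => sq_nonneg _) hk2

theorem sq_sub_le_of_unit {u v : ℝ} (huv : u ^ 2 + v ^ 2 = 1) (a b : ℝ) :
    ((u * Real.cos a + v * Real.sin a) - (u * Real.cos b + v * Real.sin b)) ^ 2 ≤ (a - b) ^ 2 := by
  have h1 := Real.one_sub_sq_div_two_le_cos (x := a - b)
  rw [Real.cos_sub] at h1
  have h2 := Real.sin_sq_add_cos_sq a
  have h3 := Real.sin_sq_add_cos_sq b
  have h4 : ((u * Real.cos a + v * Real.sin a) - (u * Real.cos b + v * Real.sin b)) ^ 2 ≤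
      (u ^ 2 + v ^ 2) * ((Real.cos a - Real.cos b) ^ 2 + (Real.sin a - Real.sin b) ^ 2) := by
    nlinarith [sq_nonneg (u * (Real.sin a - Real.sin b) - v * (Real.cos a - Real.cos b))]
  rw [huv, one_mul] at h4
  nlinarith

/-- The tangent of a nearly closed curve with bounded energy is quantitatively spread. -/
theorem le_integral_sq_of_unit {θ k : ℝ → ℝ} (hk : MemL2 k) (hθ : IsPrimitive θ k) {c ℓ : ℝ}
    (hc : ∫ x in (0 : ℝ)..1, k x ^ 2 ≤ c) (hc0 : 0 ≤ c) (hℓ0 : 0 ≤ ℓ) (hℓ : ℓ ≤ 1 / 2)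
    (hcos : ∫ x in (0 : ℝ)..1, Real.cos (θ x) = ℓ) (hsin : ∫ x in (0 : ℝ)..1, Real.sin (θ x) = 0)
    {u v : ℝ} (huv : u ^ 2 + v ^ 2 = 1) :
    1 / (36 * (c + 1)) ≤
      ∫ x in (0 : ℝ)..1, (u * Real.cos (θ x) + v * Real.sin (θ x)) ^ 2 := by
  have hθc : ContinuousOn θ (uIcc 0 1) := by rw [uIcc_of_le zero_le_one]; exact hθ.continuousOn
  have hcc : ContinuousOn (fun x => Real.cos (θ x)) (uIcc 0 1) :=
    Real.continuous_cos.comp_continuousOn hθc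
  have hsc : ContinuousOn (fun x => Real.sin (θ x)) (uIcc 0 1) :=
    Real.continuous_sin.comp_continuousOn hθc
  have hv : v ^ 2 ≤ 1 := by nlinarith [sq_nonneg u]
  -- The component orthogonal to `(u, v)` has mean `-vℓ` and attains it at some `x₀`. There the
  -- squared component along `(u, v)` is `1 - v²ℓ² ≥ 3/4`.
  obtain ⟨x₀, hx₀, hg⟩ := exists_eq_interval_average zero_ne_one
    (f := fun x => u * Real.sin (θ x) - v * Real.cos (θ x))
    ((continuousOn_const.mul hsc).sub (continuousOn_const.mul hcc))
  rw [interval_average_eq_div, intervalIntegral.integral_sub (hsc.intervalIntegrable.const_mul _)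
    (hcc.intervalIntegrable.const_mul _), intervalIntegral.integral_const_mul,
    intervalIntegral.integral_const_mul, hcos, hsin] at hg
  rw [uIoo_of_le zero_le_one] at hx₀
  have hx₀I := Ioo_subset_Icc_self hx₀
  have hf₀ : 3 / 4 ≤ (u * Real.cos (θ x₀) + v * Real.sin (θ x₀)) ^ 2 := by
    have h1 := Real.sin_sq_add_cos_sq (θ x₀)
    have h2 : (u * Real.cos (θ x₀) + v * Real.sin (θ x₀)) ^ 2 +
        (u * Real.sin (θ x₀) - v * Real.cos (θ x₀)) ^ 2 = 1 := by
      linear_combination (u ^ 2 + v ^ 2) * h1 + huv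
    rw [hg] at h2
    nlinarith [mul_nonneg hℓ0 hℓ0, mul_le_mul hℓ hℓ hℓ0 (by norm_num),
      mul_nonneg (sq_nonneg v) (mul_nonneg hℓ0 hℓ0)]
  have hc1 : 0 < c + 1 := by linarith
  -- Within distance `r` of `x₀` the angle moves by at most `1/3`, and `r ≤ 1/2` leaves room for an
  -- interval of length `r` on one side of `x₀`. The square stays above `1/4` there, which gives the
  -- bound `r / 4`.
  set r : ℝ := 1 / (9 * (c + 1)) with hr
  have hr0 : 0 < r := by positivity
  have hr1 : r ≤ 1 / 2 := by
    rw [hr, div_le_div_iff₀ (by positivity) (by norm_num)]; linarith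
  have hcr : c * r ≤ 1 / 9 := by
    rw [hr, mul_one_div, div_le_div_iff₀ (by positivity) (by norm_num)]; linarith
  obtain ⟨a, ha0, ha1, hax⟩ : ∃ a : ℝ, 0 ≤ a ∧ a + r ≤ 1 ∧ ∀ x ∈ Icc a (a + r), |x - x₀| ≤ r := by
    rcases le_total x₀ (1 / 2) with h | h
    · exact ⟨x₀, hx₀.1.le, by linarith, fun x hx => abs_le.2 ⟨by linarith [hx.1], by linarith [hx.2]⟩⟩
    · exact ⟨x₀ - r, by linarith, by linarith [hx₀.2],
        fun x hx => abs_le.2 ⟨by linarith [hx.1], by linarith [hx.2]⟩⟩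
  have hlow : ∀ x ∈ Icc a (a + r), 1 / 4 ≤ (u * Real.cos (θ x) + v * Real.sin (θ x)) ^ 2 := by
    intro x hx
    have h1 := hθ.sq_sub_le hk hc hx₀I (y := x) ⟨ha0.trans hx.1, hx.2.trans ha1⟩
    have h2 := mul_le_mul_of_nonneg_left (hax x hx) hc0
    have h3 := sq_sub_le_of_unit huv (θ x) (θ x₀)
    have h4 : ((u * Real.cos (θ x) + v * Real.sin (θ x)) -
        (u * Real.cos (θ x₀) + v * Real.sin (θ x₀))) ^ 2 ≤ 1 / 9 := by linarith
    -- With `f` and `f₀` the components at `x` and `x₀`, this is `f₀² ≤ 2 f² + 2 (f - f₀)²`, so `f²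
    -- ≥ (3/4 - 2/9) / 2 > 1/4`.
    nlinarith [sq_nonneg (2 * (u * Real.cos (θ x) + v * Real.sin (θ x)) -
      (u * Real.cos (θ x₀) + v * Real.sin (θ x₀)))]
  have hF : ContinuousOn (fun x => (u * Real.cos (θ x) + v * Real.sin (θ x)) ^ 2) (uIcc 0 1) :=
    ((continuousOn_const.mul hcc).add (continuousOn_const.mul hsc)).pow 2
  have hle : a ≤ a + r := by linarith
  calc 1 / (36 * (c + 1)) = ∫ x in a..a + r, (1 / 4 : ℝ) := by
        rw [intervalIntegral.integral_const, smul_eq_mul, hr]; field_simp; norm_num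
    _ ≤ ∫ x in a..a + r, (u * Real.cos (θ x) + v * Real.sin (θ x)) ^ 2 := by
        refine intervalIntegral.integral_mono_on hle intervalIntegrable_const ?_ hlow
        refine (hF.mono ?_).intervalIntegrable
        rw [uIcc_of_le hle, uIcc_of_le zero_le_one]; exact Icc_subset_Icc ha0 ha1
    _ ≤ _ := intervalIntegral.integral_mono_interval ha0 hle ha1
        (Eventually.of_forall fun x => sq_nonneg _) hF.intervalIntegrable

/-- A nondegenerate symmetric `2 × 2` system with unit trace, with a bound for its solution. -/
theorem exists_solution_of_form_ge {A B D lam ℓ : ℝ} (hl : 0 < lam) (hℓ : 0 ≤ ℓ) (htr : A + D = 1)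
    (h : ∀ u v : ℝ, u ^ 2 + v ^ 2 = 1 → lam ≤ A * u ^ 2 + 2 * B * (u * v) + D * v ^ 2) :
    ∃ a b : ℝ, |a| ≤ ℓ / lam ^ 2 ∧ |b| ≤ ℓ / lam ^ 2 ∧ ℓ + a * A + b * B = 0 ∧ a * B + b * D = 0 := by
  have hA : lam ≤ A := by simpa using h 1 0 (by norm_num)
  have hD : lam ≤ D := by simpa using h 0 1 (by norm_num)
  have hA0 : 0 < A := hl.trans_le hA
  have hdet : lam ^ 2 ≤ A * D - B ^ 2 := by
    have hn : 0 < Real.sqrt (B ^ 2 + A ^ 2) := Real.sqrt_pos.2 (by positivity)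
    have hn2 : Real.sqrt (B ^ 2 + A ^ 2) ^ 2 = B ^ 2 + A ^ 2 := Real.sq_sqrt (by positivity)
    set n := Real.sqrt (B ^ 2 + A ^ 2)
    -- On the vector `(B, -A)`, which the first row annihilates, the form equals `A (AD - B²)`; this
    -- bounds the determinant below by `lam * A`.
    have h1 := h (B / n) (-A / n) (by field_simp; linarith)
    have h2 : A * (B / n) ^ 2 + 2 * B * (B / n * (-A / n)) + D * (-A / n) ^ 2 =
        A * (A * D - B ^ 2) / n ^ 2 := by field_simp; ring
    rw [h2, le_div_iff₀ (by positivity), hn2] at h1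
    have h3 : lam * A ^ 2 ≤ A * (A * D - B ^ 2) := by nlinarith [mul_nonneg hl.le (sq_nonneg B)]
    have h4 : lam * A ≤ A * D - B ^ 2 := by
      refine le_of_mul_le_mul_left ?_ hA0
      linarith
    nlinarith
  have hl2 : 0 < lam ^ 2 := by positivity
  have hdet0 : 0 < A * D - B ^ 2 := hl2.trans_le hdet
  have hD1 : |D| ≤ 1 := by rw [abs_of_pos (hl.trans_le hD)]; linarith
  have hB1 : |B| ≤ 1 := abs_le_one_iff_mul_self_le_one.2 (by nlinarith)
  have hbd : ∀ z : ℝ, |z| ≤ 1 → |ℓ * z / (A * D - B ^ 2)| ≤ ℓ / lam ^ 2 := by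
    intro z hz
    rw [abs_div, abs_mul, abs_of_nonneg hℓ, abs_of_pos hdet0]
    refine div_le_div₀ hℓ ?_ hl2 hdet
    nlinarith
  -- Cramer's rule.
  refine ⟨ℓ * -D / (A * D - B ^ 2), ℓ * B / (A * D - B ^ 2), hbd _ (by rwa [abs_neg]), hbd _ hB1,
    ?_, ?_⟩
  · linear_combination -ℓ * div_self hdet0.ne'
  · field_simp; ring

/-- Changing only the speed to `V(θ)`, within `δ = 2ℓ / lam²` of one, closes the curve. The length
is then at most `1 + δ` and the weighted energy at most `c / (1 - δ)`. -/
theorem four_mul_varpiStar_le_of_almost_closed {θ k : ℝ → ℝ} (hk : MemL2 k) (hθ : IsPrimitive θ k)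
    (h01 : θ 1 = θ 0) {c ℓ lam : ℝ} (hlam : lam = 1 / (36 * (c + 1)))
    (hc : ∫ x in (0 : ℝ)..1, k x ^ 2 ≤ c) (hc0 : 0 ≤ c) (hℓ0 : 0 ≤ ℓ) (hℓ : ℓ ≤ 1 / 2)
    (hδ : 2 * (ℓ / lam ^ 2) < 1)
    (hcos : ∫ x in (0 : ℝ)..1, Real.cos (θ x) = ℓ)
    (hsin : ∫ x in (0 : ℝ)..1, Real.sin (θ x) = 0) :
    4 * varpiStar ≤ ENNReal.ofReal
      ((1 + 2 * (ℓ / lam ^ 2)) * (c / (1 - 2 * (ℓ / lam ^ 2)))) := by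
  have hl : 0 < lam := by rw [hlam]; positivity
  have hθc : ContinuousOn θ (uIcc 0 1) := by rw [uIcc_of_le zero_le_one]; exact hθ.continuousOn
  have hcc : ContinuousOn (fun x => Real.cos (θ x)) (uIcc 0 1) :=
    Real.continuous_cos.comp_continuousOn hθc
  have hsc : ContinuousOn (fun x => Real.sin (θ x)) (uIcc 0 1) :=
    Real.continuous_sin.comp_continuousOn hθc
  have ic := hcc.intervalIntegrable (μ := volume)
  have is := hsc.intervalIntegrable (μ := volume)
  have icc : IntervalIntegrable (fun x => Real.cos (θ x) ^ 2) volume 0 1 :=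
    (hcc.pow 2).intervalIntegrable
  have iss : IntervalIntegrable (fun x => Real.sin (θ x) ^ 2) volume 0 1 :=
    (hsc.pow 2).intervalIntegrable
  have isc : IntervalIntegrable (fun x => Real.sin (θ x) * Real.cos (θ x)) volume 0 1 :=
    (hsc.mul hcc).intervalIntegrable
  set A := ∫ x in (0 : ℝ)..1, Real.cos (θ x) ^ 2 with hA
  set B := ∫ x in (0 : ℝ)..1, Real.sin (θ x) * Real.cos (θ x) with hB
  set D := ∫ x in (0 : ℝ)..1, Real.sin (θ x) ^ 2 with hD
  have htr : A + D = 1 := by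
    rw [hA, hD, ← intervalIntegral.integral_add icc iss]
    simp
  obtain ⟨a, b, ha, hb, e1, e2⟩ := exists_solution_of_form_ge (A := A) (B := B) (D := D) hl hℓ0 htr (by
    intro u v huv
    have := le_integral_sq_of_unit hk hθ hc hc0 hℓ0 hℓ hcos hsin huv
    rw [← hlam] at this
    refine this.trans (le_of_eq ?_)
    have e : ∀ x, (u * Real.cos (θ x) + v * Real.sin (θ x)) ^ 2 =
        u ^ 2 * Real.cos (θ x) ^ 2 + 2 * (u * v) * (Real.sin (θ x) * Real.cos (θ x)) +
          v ^ 2 * Real.sin (θ x) ^ 2 := fun x => by ring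
    simp only [e]
    rw [intervalIntegral.integral_add ((icc.const_mul _).add (isc.const_mul _)) (iss.const_mul _),
      intervalIntegral.integral_add (icc.const_mul _) (isc.const_mul _),
      intervalIntegral.integral_const_mul, intervalIntegral.integral_const_mul,
      intervalIntegral.integral_const_mul]
    ring)
  set δ := 2 * (ℓ / lam ^ 2) with hδd
  set V : ℝ → ℝ := fun τ => 1 + a * Real.cos τ + b * Real.sin τ with hV
  have hVb : ∀ τ, |V τ - 1| ≤ δ := by
    intro τ
    have h1 : |a * Real.cos τ| ≤ ℓ / lam ^ 2 := by
      rw [abs_mul]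
      exact (mul_le_of_le_one_right (abs_nonneg _) (Real.abs_cos_le_one _)).trans ha
    have h2 : |b * Real.sin τ| ≤ ℓ / lam ^ 2 := by
      rw [abs_mul]
      exact (mul_le_of_le_one_right (abs_nonneg _) (Real.abs_sin_le_one _)).trans hb
    have : V τ - 1 = a * Real.cos τ + b * Real.sin τ := by rw [hV]; ring
    rw [this]
    exact (abs_add_le _ _).trans (by linarith)
  have hVlo : ∀ τ, 1 - δ ≤ V τ := fun τ => by linarith [(abs_le.1 (hVb τ)).1]
  have hVhi : ∀ τ, V τ ≤ 1 + δ := fun τ => by linarith [(abs_le.1 (hVb τ)).2]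
  have hδ1 : 0 < 1 - δ := by linarith
  have hVpos : ∀ τ, 0 < V τ := fun τ => hδ1.trans_le (hVlo τ)
  have hVd : ContDiff ℝ 1 V := by
    rw [hV]
    exact (contDiff_const.add (contDiff_const.mul Real.contDiff_cos)).add
      (contDiff_const.mul Real.contDiff_sin)
  have hVc : ContinuousOn (fun x => V (θ x)) (uIcc 0 1) := hVd.continuous.comp_continuousOn hθc
  have key := four_mul_varpiStar_le hk hθ h01 hVd hVpos
    (by
      have e : ∀ x, V (θ x) * Real.cos (θ x) = Real.cos (θ x) + a * Real.cos (θ x) ^ 2 +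
          b * (Real.sin (θ x) * Real.cos (θ x)) := fun x => by rw [hV]; ring
      simp only [e]
      rw [intervalIntegral.integral_add (ic.add (icc.const_mul _)) (isc.const_mul _),
        intervalIntegral.integral_add ic (icc.const_mul _),
        intervalIntegral.integral_const_mul, intervalIntegral.integral_const_mul, hcos, e1])
    (by
      have e : ∀ x, V (θ x) * Real.sin (θ x) = Real.sin (θ x) +
          a * (Real.sin (θ x) * Real.cos (θ x)) + b * Real.sin (θ x) ^ 2 := fun x => by
        rw [hV]; ring
      simp only [e]
      rw [intervalIntegral.integral_add (is.add (isc.const_mul _)) (iss.const_mul _),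
        intervalIntegral.integral_add is (isc.const_mul _),
        intervalIntegral.integral_const_mul, intervalIntegral.integral_const_mul, hsin, zero_add,
        e2])
  refine key.trans (ENNReal.ofReal_le_ofReal ?_)
  have hδ0 : 0 ≤ δ := by positivity
  have hk2 : IntervalIntegrable (fun x => k x ^ 2) volume 0 1 :=
    intervalIntegrable_unit_iff.2 ((memLp_two_iff_integrable_sq hk.aestronglyMeasurable).1 hk)
  refine mul_le_mul ?_ ?_ ?_ (by linarith)
  · calc ∫ x in (0 : ℝ)..1, V (θ x) ≤ ∫ x in (0 : ℝ)..1, (1 + δ) :=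
          intervalIntegral.integral_mono_on zero_le_one hVc.intervalIntegrable
            intervalIntegrable_const fun x _ => hVhi _
      _ = 1 + δ := by simp
  · calc ∫ x in (0 : ℝ)..1, k x ^ 2 / V (θ x) ≤ ∫ x in (0 : ℝ)..1, k x ^ 2 / (1 - δ) := by
          refine intervalIntegral.integral_mono_on zero_le_one ?_ (hk2.div_const _) fun x _ =>
            div_le_div_of_nonneg_left (sq_nonneg _) hδ1 (hVlo _)
          rw [uIcc_of_le zero_le_one] at hVc
          exact hk.integrable_sq_div hVc fun x _ => hVpos _
      _ = (∫ x in (0 : ℝ)..1, k x ^ 2) / (1 - δ) := intervalIntegral.integral_div _ _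
      _ ≤ c / (1 - δ) := div_le_div_of_nonneg_right hc hδ1.le
  · exact intervalIntegral.integral_nonneg zero_le_one fun x _ =>
      div_nonneg (sq_nonneg _) (hVpos _).le

/-! ### Passage to the limit -/

theorem eventually_le_bending {c : ℝ≥0∞} (hc : c < 4 * varpiStar) :
    ∀ᶠ ℓ in 𝓝[>] (0 : ℝ), ∀ γ ∈ balancedCurves ℓ, c ≤ bending γ := by
  have hctop : c ≠ ⊤ := hc.ne_top
  have hc0 : 0 ≤ c.toReal := ENNReal.toReal_nonneg
  -- The nondegeneracy constant depends on the energy bound only, so the smallness required of `ℓ`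
  -- is uniform over all curves.
  obtain ⟨lam, hlam⟩ : ∃ lam : ℝ, lam = 1 / (36 * (c.toReal + 1)) := ⟨_, rfl⟩
  have hδ : Tendsto (fun ℓ : ℝ => 2 * (ℓ / lam ^ 2)) (𝓝 0) (𝓝 0) := by
    have : Continuous fun ℓ : ℝ => 2 * (ℓ / lam ^ 2) := by fun_prop
    simpa using this.tendsto 0
  have hlim : Tendsto (fun ℓ : ℝ => ENNReal.ofReal
      ((1 + 2 * (ℓ / lam ^ 2)) * (c.toReal / (1 - 2 * (ℓ / lam ^ 2))))) (𝓝 0) (𝓝 c) := by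
    have h1 : Tendsto (fun ℓ : ℝ => (1 + 2 * (ℓ / lam ^ 2)) *
        (c.toReal / (1 - 2 * (ℓ / lam ^ 2)))) (𝓝 0) (𝓝 ((1 + 0) * (c.toReal / (1 - 0)))) :=
      (hδ.const_add 1).mul (tendsto_const_nhds.div (hδ.const_sub 1) (by norm_num))
    have h2 := ENNReal.tendsto_ofReal h1
    rwa [sub_zero, div_one, add_zero, one_mul, ENNReal.ofReal_toReal hctop] at h2
  filter_upwards [self_mem_nhdsWithin, nhdsWithin_le_nhds (hlim.eventually_lt_const hc),
    nhdsWithin_le_nhds (hδ.eventually_lt_const one_pos),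
    nhdsWithin_le_nhds (eventually_lt_nhds (show (0 : ℝ) < 1 / 2 by norm_num))]
    with ℓ hpos hlt hδ1 hhalf γ hγ
  by_contra! hB
  obtain ⟨θ, k, hk, hθ, h01, hcos, hsin, hbend⟩ := exists_angle_of_mem_balancedCurves hγ
  rw [hbend] at hB
  have hkc : ∫ x in (0 : ℝ)..1, k x ^ 2 ≤ c.toReal :=
    (ENNReal.ofReal_le_iff_le_toReal hctop).1 hB.le
  exact absurd hlt (not_lt.2 (four_mul_varpiStar_le_of_almost_closed hk hθ h01 hlam hkc hc0
    (le_of_lt hpos) hhalf.le hδ1 hcos hsin))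

end PinnedCurve

theorem lemma2p8 :
    4 * PinnedCurve.varpiStar ≤
      liminf (fun ℓ : ℝ => ⨅ γ ∈ PinnedCurve.balancedCurves ℓ, PinnedCurve.bending γ)
        (𝓝[>] (0 : ℝ)) := by
  refine le_of_forall_lt fun c hc => ?_
  -- The eventual bound yields only a weak inequality for the lower limit, so strictness is secured
  -- by an intermediate value.
  obtain ⟨c', h1, h2⟩ := exists_between hc
  refine h1.trans_le (le_liminf_of_le (by isBoundedDefault) ?_)
  filter_upwards [PinnedCurve.eventually_le_bending h2] with ℓ hℓ
  exact le_iInf₂ hℓ
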